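/- Let $\mathbb N=\{1,2,\dots\}$. For $x\in[0,1]$ put $d_1(x)=\lfloor 1/x\rfloor$ and $T(x)=1-d_1(x)x$ if $x\neq 0$, and $d_1(0)=\infty$, $T(0)=0$; let $d_k(x)=d_1(T^{k-1}(x))$ for $k\ge 1$ be the Pierce expansion digits of $x$, and $d(x)=(d_k(x))_{k\ge1}$. For a sequence $\sigma=(\sigma_k)_{k\ge 1}$ in $\mathbb N\cup\{\infty\}$ with $\sigma_k\ge 2$ for all $k\ge 2$, and $N\in\mathbb N$, let $$L(\sigma,N)=\#\Big\{m\in\{1,\dots,N\}:\ \sum_{k\ge1}(-1)^{k+1}\operatorname{mul}(m,\sigma_1\cdots\sigma_k)=1\Big\},$$ where $\operatorname{mul}(m,n)=1$ if $n$ is finite and divides $m$, and $\operatorname{mul}(m,n)=0$ otherwise (a product with a factor $\infty$ is $\infty$). For $\alpha\in[0,\infty]$ let $$S(\alpha)=\Big\{x\in[0,1]:\ \limsup_{N\to\infty}\frac{Nx-L(d(x),N)}{\sqrt{\log N}}=\frac1{\sqrt{2\alpha}}\ \text{ and }\ \liminf_{N\to\infty}\frac{Nx-L(d(x),N)}{\sqrt{\log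 N}}=-\frac1{\sqrt{2\alpha}}\Big\},$$ with the conventions $1/0=\infty$ and $1/\infty=0$, the limits being taken in $[-\infty,\infty]$. **Theorem 1.3.** For every $\alpha\in[0,\infty]$: (i) $S(\alpha)$ is dense in $[0,1]$; (ii) for every non-empty open subset $U$ of $[0,1]$ (with the subspace topology), the set $U\cap S(\alpha)$ has Hausdorff dimension $1$. -/

import Mathlib

open scoped ENNReal

namespace LeapYear

noncomputable section

/-- First Pierce digit: `d₁(x) = ⌊1/x⌋` for `x ≠ 0` and `d₁(0) = ∞` (used for `x ∈ [0,1]`). -/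
def firstDigit (x : ℝ) : ℕ∞ :=
  if x = 0 then ⊤ else ((⌊1 / x⌋₊ : ℕ) : ℕ∞)

/-- The Pierce map: `T(x) = 1 - d₁(x) x` for `x ≠ 0` and `T(0) = 0` (used for `x ∈ [0,1]`). -/
def pierceMap (x : ℝ) : ℝ :=
  if x = 0 then 0 else 1 - (⌊1 / x⌋₊ : ℝ) * x

/-- The Pierce digit sequence, indexed from `0`: `pierceDigit x k` is
`d_{k+1}(x) = d₁(T^k(x))`. -/
def pierceDigit (x : ℝ) (k : ℕ) : ℕ∞ :=
  firstDigit (pierceMap^[k] x)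

open Classical in
/-- The indicator of "`m` is an integer multiple of `n`". For positive `m` it vanishes at
`n = ∞`. -/
def mulIndicator (m : ℕ) (n : ℕ∞) : ℤ :=
  if ∃ q : ℕ, (m : ℕ∞) = (q : ℕ∞) * n then 1 else 0

/-- The rule with intercalation sequence `σ` declares the year `m` (a positive integer) a leap
year if `∑_{k ≥ 1} (-1)^{k+1} mul(m, σ₁ ⋯ σ_k) = 1`. The sequence is indexed from `0`, so that
`σ_k` is `σ (k - 1)`; a finite sequence is continued by `∞`, which adds only zero terms.
If no term is `0` and all terms but the first are at least `2`, only finitely many summands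
are non-zero. -/
def IsLeapYear (σ : ℕ → ℕ∞) (m : ℕ) : Prop :=
  ∑ᶠ k : ℕ, (-1 : ℤ) ^ k * mulIndicator m (∏ i ∈ Finset.range (k + 1), σ i) = 1

open Classical in
/-- `L(σ, N)`: the number of leap years among the years `1, …, N`. -/
def leapYearCount (σ : ℕ → ℕ∞) (N : ℕ) : ℕ :=
  ((Finset.Icc 1 N).filter (fun m => IsLeapYear σ m)).card

/-- The quotient `(N x - L((d_k(x))_k, N)) / √(log N)`, as an extended real number. -/
def leapQuotient (x : ℝ) (N : ℕ) : EReal :=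
  ((((N : ℝ) * x - (leapYearCount (pierceDigit x) N : ℝ)) / √(Real.log N) : ℝ) : EReal)

/-- `1/√(2α)` for `α ∈ [0,∞]`, with `1/0 = ∞` and `1/∞ = 0`. -/
def invSqrtTwoMul (α : ℝ≥0∞) : ℝ≥0∞ :=
  1 / (2 * α) ^ (1 / 2 : ℝ)

/-- The set `S(α)`, as a subset of the unit interval `[0,1]`. -/
def S (α : ℝ≥0∞) : Set unitInterval :=
  {x | Filter.limsup (leapQuotient (x : ℝ)) Filter.atTop = ((invSqrtTwoMul α : ℝ≥0∞) : EReal) ∧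
    Filter.liminf (leapQuotient (x : ℝ)) Filter.atTop = -((invSqrtTwoMul α : ℝ≥0∞) : EReal)}

end

end LeapYear

namespace LeapYear

open Filter Topology Finset Asymptotics

/-! Write `P n` for the product of the first `n` digits of `x`. The divisibility conditions defining
leap years are nested, so their alternating sum is always 0 or 1, and the leap year count is an
alternating sum of floors of `N / P (k + 1)`. For `N < P n` the deviation is therefore, up to an
error of 1, the alternating sum of `n` fractional parts. Centring these at 1/2 bounds it by `n / 2 +
O(1)`. Conversely, mixed radix digits that alternate between maximal and zero push the fractional
parts close to 1 and 0 in turn and reach both signs of `n / 2`, up to `o(n)`. Hence limsup and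
liminf are plus and minus the limit of `(n / 2) / √(log (P n))`. If `log d_k / k → α`, then `log (P
n) / n ^ 2 → α / 2` and this limit is `1 / √(2α)` (`IsPierceSeq.pierceSum_mem_S`,
`IsPierceSeq.tendsto_of_tendsto_log_div`).

It remains to find many such `x` near any point. Fix a prefix, then let the `k`-th digit range
freely over an interval between consecutive values of `⌊exp g⌋`, with `g k / k → α`. On a
logarithmic scale an interval has as many points as its right endpoint is large, while sums that
first differ at position `n` are separated by nearly the reciprocal of the product of the first `n`
endpoints. Coding the choices by a Cantor series gives a map onto `[0,1)` that is Hölder of every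
exponent `r < 1`, so the dimension is 1 (`le_dimH_of_prod_le`, `IsRegularGrowth.exists_digitBox`).
-/

/-- The digit sequences of infinite Pierce expansions: strictly increasing sequences of positive
integers. -/
structure IsPierceSeq (d : ℕ → ℕ) : Prop where
  pos_zero : 0 < d 0
  strictMono : StrictMono d

/-- The product of the first `n` terms of a sequence. -/
def digitProd (d : ℕ → ℕ) (n : ℕ) : ℕ := ∏ i ∈ range n, d i

/-- The sum of the alternating series with the Pierce digits `d`. -/
noncomputable def pierceSum (d : ℕ → ℕ) : ℝ :=
  ∑' k : ℕ, (-1 : ℝ) ^ k * (1 / (digitProd d (k + 1) : ℝ))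

/-- The sequence with its first `n` terms deleted. -/
def tailSeq (d : ℕ → ℕ) (n : ℕ) : ℕ → ℕ := fun k => d (n + k)

@[simp] lemma digitProd_zero (d : ℕ → ℕ) : digitProd d 0 = 1 := by simp [digitProd]

lemma digitProd_succ (d : ℕ → ℕ) (n : ℕ) : digitProd d (n + 1) = digitProd d n * d n := by
  simp [digitProd, prod_range_succ]

lemma digitProd_succ' (d : ℕ → ℕ) (n : ℕ) :
    digitProd d (n + 1) = d 0 * digitProd (tailSeq d 1) n := by
  simp [digitProd, prod_range_succ', tailSeq, mul_comm, add_comm]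

lemma digitProd_dvd (d : ℕ → ℕ) {m n : ℕ} (h : m ≤ n) : digitProd d m ∣ digitProd d n :=
  prod_dvd_prod_of_subset _ _ _ (by simpa using h)

@[simp] lemma tailSeq_zero (d : ℕ → ℕ) : tailSeq d 0 = d := by
  ext k; simp [tailSeq]

lemma tailSeq_tailSeq (d : ℕ → ℕ) (m n : ℕ) : tailSeq (tailSeq d m) n = tailSeq d (m + n) := by
  ext k; simp [tailSeq, add_assoc]

/-! ### Pierce series and the recovery of their digits -/

namespace IsPierceSeq

variable {d : ℕ → ℕ}

lemma succ_le (hd : IsPierceSeq d) (k : ℕ) : k + 1 ≤ d k := by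
  induction k with
  | zero => exact hd.pos_zero
  | succ k ih => have := hd.strictMono (Nat.lt_add_one k); omega

lemma pos (hd : IsPierceSeq d) (k : ℕ) : 0 < d k := by
  have := hd.succ_le k; omega

lemma cast_pos (hd : IsPierceSeq d) (k : ℕ) : (0 : ℝ) < d k := by exact_mod_cast hd.pos k

lemma tailSeq (hd : IsPierceSeq d) (n : ℕ) : IsPierceSeq (tailSeq d n) :=
  ⟨hd.pos _, fun _ _ h => hd.strictMono (by omega)⟩

lemma factorial_le_digitProd (hd : IsPierceSeq d) (n : ℕ) : n.factorial ≤ digitProd d n := by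
  induction n with
  | zero => simp
  | succ n ih =>
    rw [digitProd_succ, Nat.factorial_succ, mul_comm]
    exact Nat.mul_le_mul ih (hd.succ_le n)

lemma digitProd_pos (hd : IsPierceSeq d) (n : ℕ) : 0 < digitProd d n :=
  (Nat.factorial_pos n).trans_le (hd.factorial_le_digitProd n)

lemma digitProd_cast_pos (hd : IsPierceSeq d) (n : ℕ) : (0 : ℝ) < digitProd d n := by
  exact_mod_cast hd.digitProd_pos n

lemma digitProd_mono (hd : IsPierceSeq d) : Monotone (digitProd d) := fun _ _ h =>
  Nat.le_of_dvd (hd.digitProd_pos _) (digitProd_dvd d h)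

lemma tendsto_digitProd (hd : IsPierceSeq d) : Tendsto (digitProd d) atTop atTop :=
  tendsto_atTop_mono (fun n => (Nat.self_le_factorial n).trans (hd.factorial_le_digitProd n))
    tendsto_id

lemma summable (hd : IsPierceSeq d) :
    Summable fun k : ℕ => (-1 : ℝ) ^ k * (1 / (digitProd d (k + 1) : ℝ)) := by
  have h := (summable_nat_add_iff 1).2 (Real.summable_pow_div_factorial 1)
  refine Summable.of_norm_bounded h fun k => ?_
  rw [norm_mul, norm_pow, norm_neg, norm_one, one_pow, one_mul, one_pow, Real.norm_of_nonneg
    (by positivity)]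
  gcongr
  exact hd.factorial_le_digitProd _

lemma pierceSum_eq (hd : IsPierceSeq d) :
    pierceSum d = (1 - pierceSum (LeapYear.tailSeq d 1)) / d 0 := by
  have h0 := (hd.cast_pos 0).ne'
  rw [pierceSum, hd.summable.tsum_eq_zero_add, pierceSum, sub_div, sub_eq_add_neg, ← tsum_div_const,
    ← tsum_neg]
  congr 1
  · simp [digitProd_succ]
  · refine tsum_congr fun k => ?_
    rw [digitProd_succ']
    push_cast
    have := ((hd.tailSeq 1).digitProd_cast_pos (k + 1)).ne'
    field_simp
    ring

lemma pierceSum_mem_Icc (hd : IsPierceSeq d) : pierceSum d ∈ Set.Icc 0 (1 / (d 0 : ℝ)) := by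
  have ht := hd.summable.hasSum.tendsto_sum_nat
  have ha : Antitone fun k => 1 / (digitProd d (k + 1) : ℝ) := fun m n h => by
    have := hd.digitProd_cast_pos (m + 1)
    have h' : (digitProd d (m + 1) : ℝ) ≤ digitProd d (n + 1) := by
      exact_mod_cast hd.digitProd_mono (by omega)
    exact one_div_le_one_div_of_le this h'
  refine ⟨?_, ?_⟩
  · simpa [pierceSum] using ha.alternating_series_le_tendsto ht 0
  · have := ha.tendsto_le_alternating_series ht 0
    rwa [mul_zero, zero_add, sum_range_one, pow_zero, one_mul, zero_add, digitProd_succ,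
      digitProd_zero, one_mul] at this

/-- Strictness is what identifies the floor of `1 / x` as `d 0`. It comes from the second tail being
positive, which makes the first tail smaller than `1 / d 1 ≤ 1 / (d 0 + 1)`. -/
lemma one_div_lt_pierceSum (hd : IsPierceSeq d) : 1 / ((d 0 : ℝ) + 1) < pierceSum d := by
  rw [hd.pierceSum_eq]
  have h0 := hd.cast_pos 0
  have h01 : (d 0 : ℝ) + 1 ≤ d 1 := by
    exact_mod_cast hd.strictMono (show 0 < 1 by norm_num)
  have h3 : 0 < pierceSum (LeapYear.tailSeq d 2) := by
    rw [(hd.tailSeq 2).pierceSum_eq, tailSeq_tailSeq]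
    have := (hd.tailSeq 3).pierceSum_mem_Icc.2
    have h4 : (4 : ℝ) ≤ LeapYear.tailSeq d 3 0 := by exact_mod_cast hd.succ_le 3
    have : 1 / (LeapYear.tailSeq d 3 0 : ℝ) ≤ 1 / 4 := one_div_le_one_div_of_le (by norm_num) h4
    exact div_pos (by linarith) (hd.cast_pos 2)
  have h5 : pierceSum (LeapYear.tailSeq d 1) < 1 / ((d 0 : ℝ) + 1) := by
    have h1p : (0 : ℝ) < d 1 := hd.cast_pos 1
    rw [(hd.tailSeq 1).pierceSum_eq, tailSeq_tailSeq]
    change (1 - pierceSum (LeapYear.tailSeq d 2)) / (d 1 : ℝ) < _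
    rw [div_lt_div_iff₀ h1p (by linarith)]
    nlinarith
  rw [div_lt_div_iff₀ (by linarith) h0]
  rw [lt_div_iff₀ (by linarith)] at h5
  linarith

lemma pierceSum_pos (hd : IsPierceSeq d) : 0 < pierceSum d :=
  lt_trans (by positivity) hd.one_div_lt_pierceSum

lemma pierceSum_le_one (hd : IsPierceSeq d) : pierceSum d ≤ 1 := by
  refine hd.pierceSum_mem_Icc.2.trans ?_
  rw [div_le_one (hd.cast_pos 0)]
  exact_mod_cast hd.pos 0

lemma floor_one_div_pierceSum (hd : IsPierceSeq d) : ⌊1 / pierceSum d⌋₊ = d 0 := by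
  have hp := hd.pierceSum_pos
  rw [Nat.floor_eq_iff (by positivity)]
  have h0 := hd.cast_pos 0
  refine ⟨?_, ?_⟩
  · have := hd.pierceSum_mem_Icc.2
    rwa [le_div_comm₀ h0 hp]
  · exact (one_div_lt (by positivity) hp).1 hd.one_div_lt_pierceSum

lemma pierceMap_pierceSum (hd : IsPierceSeq d) :
    pierceMap (pierceSum d) = pierceSum (LeapYear.tailSeq d 1) := by
  rw [pierceMap, if_neg hd.pierceSum_pos.ne', hd.floor_one_div_pierceSum]
  have h0 := (hd.cast_pos 0).ne'
  conv_lhs => rw [hd.pierceSum_eq]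
  field_simp
  ring

lemma iterate_pierceMap (hd : IsPierceSeq d) (n : ℕ) :
    pierceMap^[n] (pierceSum d) = pierceSum (LeapYear.tailSeq d n) := by
  induction n with
  | zero => simp
  | succ n ih =>
    rw [Function.iterate_succ_apply', ih, (hd.tailSeq n).pierceMap_pierceSum, tailSeq_tailSeq]

lemma pierceDigit_pierceSum (hd : IsPierceSeq d) (n : ℕ) :
    pierceDigit (pierceSum d) n = (d n : ℕ∞) := by
  rw [pierceDigit, hd.iterate_pierceMap, firstDigit, if_neg (hd.tailSeq n).pierceSum_pos.ne',
    (hd.tailSeq n).floor_one_div_pierceSum]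
  rfl

lemma pierceSum_tailSeq (hd : IsPierceSeq d) (n : ℕ) :
    pierceSum (LeapYear.tailSeq d n) = (1 - pierceSum (LeapYear.tailSeq d (n + 1))) / d n := by
  rw [(hd.tailSeq n).pierceSum_eq, tailSeq_tailSeq]
  rfl

end IsPierceSeq

/-! ### Truncated expansions and prefixes -/

/-- Stated for an abstract `u`, so that it covers both the tails of a Pierce series and the orbit of
a number under the Pierce map, with no convergence needed. -/
lemma eq_sum_add_of_recursion {d : ℕ → ℕ} {u : ℕ → ℝ} {n : ℕ} (hd : ∀ k < n, 0 < d k)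
    (hu : ∀ k < n, u k = (1 - u (k + 1)) / d k) :
    u 0 = ∑ k ∈ range n, (-1 : ℝ) ^ k * (1 / (digitProd d (k + 1) : ℝ)) +
      (-1) ^ n * (u n / digitProd d n) := by
  induction n with
  | zero => simp
  | succ n ih =>
    rw [ih (fun k hk => hd k (by omega)) (fun k hk => hu k (by omega)), sum_range_succ,
      hu n (by omega), digitProd_succ, Nat.cast_mul, div_div, mul_comm (d n : ℝ), sub_div, pow_succ]
    ring

lemma abs_sub_of_recursion {d : ℕ → ℕ} {u v : ℕ → ℝ} {n : ℕ} (hd : ∀ k < n, 0 < d k)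
    (hu : ∀ k < n, u k = (1 - u (k + 1)) / d k) (hv : ∀ k < n, v k = (1 - v (k + 1)) / d k) :
    |u 0 - v 0| = |u n - v n| / digitProd d n := by
  rw [eq_sum_add_of_recursion hd hu, eq_sum_add_of_recursion hd hv, add_sub_add_left_eq_sub,
    ← mul_sub, abs_mul, abs_pow, abs_neg, abs_one, one_pow, one_mul, ← sub_div, abs_div,
    Nat.abs_cast]

/-- The expansions of the numbers close to a given irrational number include all the continuations
of a long enough prefix. -/
lemma exists_prefix {z : ℝ} (hz : Irrational z) (hz0 : 0 < z) (hz1 : z < 1) {ε : ℝ} (hε : 0 < ε) :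
    ∃ (a : ℕ → ℕ) (p : ℕ), IsPierceSeq a ∧
      ∀ d, IsPierceSeq d → (∀ k < p, d k = a k) → |pierceSum d - z| < ε := by
  -- The Pierce map without its case `x = 0`: the orbit of an irrational number stays irrational and
  -- never reaches 0.
  let f : ℝ → ℝ := fun x => 1 - (⌊1 / x⌋₊ : ℝ) * x
  have hf : ∀ x : ℝ, Irrational x → 0 < x → x < 1 → 0 < ⌊1 / x⌋₊ ∧
      Irrational (f x) ∧ 0 < f x ∧ f x < 1 ∧ ⌊1 / x⌋₊ < ⌊1 / f x⌋₊ := by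
    intro x hx h0 h1
    have hfl : 0 < ⌊1 / x⌋₊ := Nat.floor_pos.2 ((one_le_div h0).2 h1.le)
    have hflR : (0 : ℝ) < ⌊1 / x⌋₊ := by exact_mod_cast hfl
    have hir : Irrational (f x) := by
      have := (hx.natCast_mul hfl.ne').ratCast_sub 1
      simpa [f] using this
    have hle : (⌊1 / x⌋₊ : ℝ) ≤ 1 / x := Nat.floor_le (by positivity)
    have hlt : 1 / x < ⌊1 / x⌋₊ + 1 := Nat.lt_floor_add_one _
    rw [le_div_iff₀ h0] at hle
    rw [div_lt_iff₀ h0] at hlt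
    have h0' : 0 < f x := lt_of_le_of_ne (by simp only [f]; linarith) hir.ne_zero.symm
    refine ⟨hfl, hir, h0', by simp only [f]; nlinarith, ?_⟩
    -- With `m = ⌊1 / x⌋`, the bound `(m + 1) * (1 - m * x) ≤ 1` amounts to `1 ≤ (m + 1) * x`.
    rw [← Nat.add_one_le_iff, Nat.le_floor_iff (by positivity), le_div_iff₀ h0']
    push_cast
    simp only [f]
    nlinarith
  let u : ℕ → ℝ := fun n => f^[n] z
  have hu : ∀ n, Irrational (u n) ∧ 0 < u n ∧ u n < 1 := by
    intro n
    induction n with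
    | zero => exact ⟨hz, hz0, hz1⟩
    | succ n ih =>
      have := hf _ ih.1 ih.2.1 ih.2.2
      simp only [u, Function.iterate_succ_apply']
      exact ⟨this.2.1, this.2.2.1, this.2.2.2.1⟩
  let a : ℕ → ℕ := fun n => ⌊1 / u n⌋₊
  have hus : ∀ n, u (n + 1) = f (u n) := fun n => Function.iterate_succ_apply' f n z
  have ha : IsPierceSeq a := by
    refine ⟨(hf _ (hu 0).1 (hu 0).2.1 (hu 0).2.2).1, strictMono_nat_of_lt_succ fun n => ?_⟩
    simp only [a, hus]
    exact (hf _ (hu n).1 (hu n).2.1 (hu n).2.2).2.2.2.2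
  have hrec : ∀ n, u n = (1 - u (n + 1)) / a n := fun n => by
    rw [hus, eq_div_iff (ha.cast_pos n).ne']
    simp only [f, a]
    ring
  obtain ⟨p, hp⟩ := (ha.tendsto_digitProd.eventually_gt_atTop ⌊1 / ε⌋₊).exists
  refine ⟨a, p, ha, fun d hd hda => ?_⟩
  have h := abs_sub_of_recursion (u := fun k => pierceSum (tailSeq d k)) (v := u) (n := p)
    (d := a) (fun k _ => ha.pos k) (fun k hk => by rw [hd.pierceSum_tailSeq, hda k hk])
    (fun k _ => hrec k)
  simp only [tailSeq_zero] at h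
  change |pierceSum d - z| = _ at h
  rw [h, div_lt_iff₀ (ha.digitProd_cast_pos p)]
  have h1 : |pierceSum (tailSeq d p) - u p| ≤ 1 := by
    have := (hd.tailSeq p).pierceSum_pos
    have := (hd.tailSeq p).pierceSum_le_one
    rw [abs_le]
    constructor <;> linarith [(hu p).2.1, (hu p).2.2]
  have h2 : 1 / ε < digitProd a p := (Nat.floor_lt (by positivity)).1 hp
  rw [div_lt_iff₀ hε] at h2
  linarith

/-! ### Leap year counts and deviations -/

lemma mulIndicator_natCast (m n : ℕ) : mulIndicator m (n : ℕ∞) = if n ∣ m then 1 else 0 := by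
  unfold mulIndicator
  congr 1
  rw [eq_iff_iff, dvd_def]
  refine exists_congr fun q => ?_
  rw [mul_comm n q]
  exact_mod_cast Iff.rfl

/-- The indicators form a block of ones followed by zeros. Consequently the alternating sum is
itself the indicator of a leap year and can be summed over `m`. -/
lemma alternating_sum_indicator (Q : ℕ → Prop) [DecidablePred Q] (hQ : ∀ k, Q (k + 1) → Q k)
    (n : ℕ) : ∑ k ∈ range n, (-1 : ℤ) ^ k * (if Q k then 1 else 0) = 0 ∨
      ∑ k ∈ range n, (-1 : ℤ) ^ k * (if Q k then 1 else 0) = 1 := by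
  induction n generalizing Q with
  | zero => simp
  | succ n ih =>
    have h := ih (fun k => Q (k + 1)) (fun k => hQ (k + 1))
    rw [sum_range_succ']
    simp only [pow_succ, mul_neg, mul_one, neg_mul, sum_neg_distrib, pow_zero, one_mul]
    by_cases h0 : Q 0
    · rw [if_pos h0]
      rcases h with h | h <;> rw [h] <;> simp
    · have hk : ∀ k, ¬ Q k := fun k => by
        induction k with
        | zero => exact h0
        | succ k ih => exact fun h => ih (hQ k h)
      simp [hk]

section Count

variable {d : ℕ → ℕ}

lemma IsPierceSeq.finsum_mulIndicator (hd : IsPierceSeq d) {m n : ℕ} (hm : 0 < m)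
    (hmn : m < digitProd d n) :
    ∑ᶠ k : ℕ, (-1 : ℤ) ^ k * mulIndicator m (∏ i ∈ range (k + 1), (d i : ℕ∞)) =
      ∑ k ∈ range n, (-1 : ℤ) ^ k * (if digitProd d (k + 1) ∣ m then 1 else 0) := by
  have h : ∀ k : ℕ, mulIndicator m (∏ i ∈ range (k + 1), (d i : ℕ∞)) =
      if digitProd d (k + 1) ∣ m then 1 else 0 := fun k => by
    rw [← mulIndicator_natCast, digitProd, Nat.cast_prod]
  simp only [h]
  refine finsum_eq_sum_of_support_subset _ fun k hk => ?_
  by_contra hkn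
  rw [coe_range, Set.mem_Iio, not_lt] at hkn
  refine hk ?_
  beta_reduce
  rw [if_neg, mul_zero]
  intro hdvd
  have := Nat.le_of_dvd hm hdvd
  have := hd.digitProd_mono (show n ≤ k + 1 by omega)
  omega

lemma IsPierceSeq.leapYearCount_eq (hd : IsPierceSeq d) {N n : ℕ} (hN : N < digitProd d n) :
    (leapYearCount (fun k => (d k : ℕ∞)) N : ℤ) =
      ∑ k ∈ range n, (-1 : ℤ) ^ k * ((N / digitProd d (k + 1) : ℕ) : ℤ) := by
  classical
  have h : ∀ m ∈ Icc 1 N, (if IsLeapYear (fun k => (d k : ℕ∞)) m then (1 : ℤ) else 0) =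
      ∑ k ∈ range n, (-1 : ℤ) ^ k * (if digitProd d (k + 1) ∣ m then 1 else 0) := fun m hm => by
    rw [mem_Icc] at hm
    rw [IsLeapYear, hd.finsum_mulIndicator (by omega) (lt_of_le_of_lt hm.2 hN)]
    rcases alternating_sum_indicator (fun k => digitProd d (k + 1) ∣ m)
      (fun k => (digitProd_dvd d (Nat.le_succ _)).trans) n with h | h <;> rw [h] <;> simp
  rw [leapYearCount, card_filter, Nat.cast_sum]
  simp only [Nat.cast_ite, Nat.cast_one, Nat.cast_zero]
  rw [sum_congr rfl h, sum_comm]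
  refine sum_congr rfl fun k _ => ?_
  rw [← mul_sum, ← Nat.Ioc_filter_dvd_card_eq_div, card_filter]
  push_cast
  rfl

/-- The accumulated deviation `N x - L(d(x), N)` for the number with Pierce digits `d`. -/
noncomputable def deviation (d : ℕ → ℕ) (N : ℕ) : ℝ :=
  (N : ℝ) * pierceSum d - (leapYearCount (fun k => (d k : ℕ∞)) N : ℝ)

/-- The fractional part of `N / (d₀ ⋯ d_k)`. -/
noncomputable def fracPart (d : ℕ → ℕ) (N k : ℕ) : ℝ :=
  ((N % digitProd d (k + 1) : ℕ) : ℝ) / digitProd d (k + 1)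

/-- Multiplying the truncated series by `N` and subtracting the floors leaves the fractional parts;
the remainder is at most `N / digitProd d n ≤ 1`. -/
lemma IsPierceSeq.abs_deviation_sub_le (hd : IsPierceSeq d) {N n : ℕ} (hN : N < digitProd d n) :
    |deviation d N - ∑ k ∈ range n, (-1 : ℝ) ^ k * fracPart d N k| ≤ 1 := by
  have h1 := eq_sum_add_of_recursion (u := fun k => pierceSum (LeapYear.tailSeq d k)) (n := n)
    (fun k _ => hd.pos k) (fun k _ => hd.pierceSum_tailSeq k)
  simp only [tailSeq_zero] at h1
  have h2 : (leapYearCount (fun k => (d k : ℕ∞)) N : ℝ) =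
      ∑ k ∈ range n, (-1 : ℝ) ^ k * ((N / digitProd d (k + 1) : ℕ) : ℝ) := by
    simpa only [Int.cast_sum, Int.cast_mul, Int.cast_pow, Int.cast_neg, Int.cast_one,
      Int.cast_natCast] using congrArg (Int.cast : ℤ → ℝ) (hd.leapYearCount_eq hN)
  have h3 : ∀ k, (N : ℝ) * (1 / (digitProd d (k + 1) : ℝ)) - ((N / digitProd d (k + 1) : ℕ) : ℝ) =
      fracPart d N k := fun k => by
    have hp := (hd.digitProd_cast_pos (k + 1)).ne'
    rw [fracPart, eq_div_iff hp, sub_mul, mul_assoc, one_div, inv_mul_cancel₀ hp, mul_one,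
      sub_eq_iff_eq_add]
    exact_mod_cast (by rw [mul_comm, Nat.mod_add_div])
  have h4 : deviation d N - ∑ k ∈ range n, (-1 : ℝ) ^ k * fracPart d N k =
      (-1) ^ n * (N * pierceSum (LeapYear.tailSeq d n) / digitProd d n) := by
    simp only [deviation, h2, ← h3, mul_sub, sum_sub_distrib]
    have : (N : ℝ) * pierceSum d = _ := congrArg (fun x => (N : ℝ) * x) h1
    rw [this, mul_add, mul_sum]
    simp only [mul_left_comm (N : ℝ)]
    ring
  have hp := hd.digitProd_cast_pos n
  have ht0 := (hd.tailSeq n).pierceSum_pos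
  have ht1 := (hd.tailSeq n).pierceSum_le_one
  have hN' : (N : ℝ) ≤ digitProd d n := by exact_mod_cast hN.le
  rw [h4, abs_mul, abs_pow, abs_neg, abs_one, one_pow, one_mul, abs_of_nonneg (by positivity),
    div_le_one hp]
  nlinarith [(Nat.cast_nonneg N : (0 : ℝ) ≤ N)]

lemma abs_alternating_sum_half_le (n : ℕ) : |∑ k ∈ range n, (-1 : ℝ) ^ k * (1 / 2)| ≤ 1 / 2 := by
  rw [← sum_mul, neg_one_geom_sum]
  split_ifs <;> norm_num

/-- Each fractional part is within 1/2 of 1/2. The constant 3/2 is the truncation error 1 plus the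
bound 1/2 for the alternating sum of the centres. -/
lemma IsPierceSeq.abs_deviation_le (hd : IsPierceSeq d) {N n : ℕ} (hN : N < digitProd d n) :
    |deviation d N| ≤ n / 2 + 3 / 2 := by
  have h1 := hd.abs_deviation_sub_le hN
  have h2 := abs_alternating_sum_half_le n
  have h3 : |∑ k ∈ range n, (-1 : ℝ) ^ k * fracPart d N k - ∑ k ∈ range n, (-1 : ℝ) ^ k * (1 / 2)|
      ≤ n / 2 := by
    rw [← sum_sub_distrib]
    refine (abs_sum_le_sum_abs _ _).trans ?_
    calc _ ≤ ∑ k ∈ range n, (1 / 2 : ℝ) := sum_le_sum fun k _ => ?_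
      _ = n / 2 := by simp [div_eq_mul_inv]
    rw [← mul_sub, abs_mul, abs_pow, abs_neg, abs_one, one_pow, one_mul]
    have hp := hd.digitProd_cast_pos (k + 1)
    have h0 : 0 ≤ fracPart d N k := by unfold fracPart; positivity
    have h1 : fracPart d N k ≤ 1 := by
      rw [fracPart, div_le_one hp]
      exact_mod_cast (Nat.mod_lt _ (hd.digitProd_pos _)).le
    rw [abs_le]
    constructor <;> linarith
  rw [abs_le] at *
  constructor <;> linarith

/-- The integer with mixed radix digits `b` below the position `n`, in the system with bases `d`. -/
def mixedRadix (d b : ℕ → ℕ) (n : ℕ) : ℕ := ∑ j ∈ range n, b j * digitProd d j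

lemma mixedRadix_succ (d b : ℕ → ℕ) (n : ℕ) :
    mixedRadix d b (n + 1) = mixedRadix d b n + b n * digitProd d n := sum_range_succ _ _

lemma mixedRadix_lt {b : ℕ → ℕ} (hb : ∀ j, b j < d j) (n : ℕ) :
    mixedRadix d b n < digitProd d n := by
  induction n with
  | zero => simp [mixedRadix]
  | succ n ih =>
    rw [mixedRadix_succ, digitProd_succ]
    nlinarith [hb n]

lemma mixedRadix_mod {b : ℕ → ℕ} (hb : ∀ j, b j < d j) {k n : ℕ} (h : k ≤ n) :
    mixedRadix d b n % digitProd d k = mixedRadix d b k := by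
  induction n, h using Nat.le_induction with
  | base => exact Nat.mod_eq_of_lt (mixedRadix_lt hb k)
  | succ n hn ih =>
    rw [mixedRadix_succ, Nat.add_mod, ih,
      Nat.mod_eq_zero_of_dvd ((digitProd_dvd d hn).mul_left (b n)), add_zero]
    exact Nat.mod_eq_of_lt (mixedRadix_lt hb k)

/-- Both signs of large deviations are attained: for even `q` the deviation is close to `n / 2`, and
for odd `q` it is close to `- n / 2`. -/
lemma IsPierceSeq.exists_large_deviation (hd : IsPierceSeq d) (q : ℕ) :
    ∃ W : ℕ → ℕ, Tendsto W atTop atTop ∧ ∀ n, W n < digitProd d n ∧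
      |deviation d (W n) - (-1) ^ q * (n / 2)| ≤ 3 / 2 + ∑ k ∈ range n, 1 / (d k : ℝ) := by
  -- The `k`-th fractional part is within `1 / d k` of `b k / d k`, so it lies near 1 when `k + q`
  -- is even and near 0 otherwise.
  let b : ℕ → ℕ := fun j => if Even (j + q) then d j - 1 else 0
  have hb : ∀ j, b j < d j := fun j => by
    have := hd.pos j
    simp only [b]
    split_ifs <;> omega
  refine ⟨mixedRadix d b, ?_, fun n => ⟨mixedRadix_lt hb n, ?_⟩⟩
  -- One of the positions `n + 1`, `n + 2` has the right parity, and there `d ≥ 2` makes the digit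
  -- nonzero. Position 0 is avoided since `d 0` may be 1.
  · rw [← tendsto_add_atTop_iff_nat 3]
    refine tendsto_atTop_mono (fun n => ?_) hd.tendsto_digitProd
    rw [mixedRadix_succ, mixedRadix_succ]
    have h1 := hd.digitProd_mono (show n ≤ n + 1 by omega)
    have h2 := hd.digitProd_mono (show n ≤ n + 2 by omega)
    rcases Nat.even_or_odd (n + 1 + q) with h | h
    · have : 1 ≤ b (n + 1) := by
        have := hd.succ_le (n + 1)
        simp only [b, if_pos h]
        omega
      nlinarith [Nat.zero_le (b (n + 2) * digitProd d (n + 2)), Nat.zero_le (mixedRadix d b (n + 1))]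
    · have h : Even (n + 2 + q) := by rw [show n + 2 + q = n + 1 + q + 1 by ring]; exact h.add_one
      have : 1 ≤ b (n + 2) := by
        have := hd.succ_le (n + 2)
        simp only [b, if_pos h]
        omega
      nlinarith [Nat.zero_le (b (n + 1) * digitProd d (n + 1)), Nat.zero_le (mixedRadix d b (n + 1))]
  · have h1 := hd.abs_deviation_sub_le (mixedRadix_lt hb n)
    have h2 := abs_alternating_sum_half_le n
    have h3 : |∑ k ∈ range n, (-1 : ℝ) ^ k * fracPart d (mixedRadix d b n) k -
        ∑ k ∈ range n, (-1 : ℝ) ^ k * (1 / 2 + (-1) ^ (k + q) * (1 / 2))| ≤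
        ∑ k ∈ range n, 1 / (d k : ℝ) := by
      rw [← sum_sub_distrib]
      refine (abs_sum_le_sum_abs _ _).trans (sum_le_sum fun k hk => ?_)
      rw [← mul_sub, abs_mul, abs_pow, abs_neg, abs_one, one_pow, one_mul]
      have hp := hd.digitProd_cast_pos k
      have hdk := hd.cast_pos k
      have hlt : (mixedRadix d b k : ℝ) ≤ digitProd d k := by exact_mod_cast (mixedRadix_lt hb k).le
      have h0 : (0 : ℝ) ≤ mixedRadix d b k := by positivity
      rw [fracPart, mixedRadix_mod hb (by simpa using hk), mixedRadix_succ, digitProd_succ]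
      push_cast
      have e : ((mixedRadix d b k : ℝ) + b k * digitProd d k) / (digitProd d k * d k) =
          (mixedRadix d b k / digitProd d k) * (1 / d k) + b k / d k := by
        field_simp
      have hr0 : 0 ≤ (mixedRadix d b k / digitProd d k : ℝ) * (1 / d k) := by positivity
      have hr1 : (mixedRadix d b k / digitProd d k : ℝ) * (1 / d k) ≤ 1 / d k :=
        mul_le_of_le_one_left (by positivity) ((div_le_one hp).2 hlt)
      rw [e]
      by_cases h : Even (k + q)
      · have e2 : (b k : ℝ) / d k = 1 - 1 / d k := by
          simp only [b, if_pos h]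
          rw [Nat.cast_sub (hd.pos k), Nat.cast_one, sub_div, div_self hdk.ne']
        rw [h.neg_one_pow, e2, abs_le]
        constructor <;> linarith
      · have e2 : (b k : ℝ) = 0 := by simp [b, h]
        rw [(Nat.not_even_iff_odd.1 h).neg_one_pow, e2, abs_le]
        constructor <;> norm_num <;> norm_num at hr0 hr1 <;> linarith
    have h4 : ∑ k ∈ range n, (-1 : ℝ) ^ k * (1 / 2 + (-1) ^ (k + q) * (1 / 2)) =
        ∑ k ∈ range n, (-1 : ℝ) ^ k * (1 / 2) + (-1) ^ q * (n / 2) := by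
      have : ∀ k : ℕ, (-1 : ℝ) ^ k * (1 / 2 + (-1) ^ (k + q) * (1 / 2)) =
          (-1 : ℝ) ^ k * (1 / 2) + (-1) ^ q * (1 / 2) := fun k => by
        have : (-1 : ℝ) ^ k * (-1) ^ k = 1 := by rw [← mul_pow]; simp
        rw [pow_add]
        linear_combination (-1 : ℝ) ^ q * (1 / 2) * this
      simp only [this, sum_add_distrib, sum_const, card_range, nsmul_eq_mul]
      ring
    rw [h4] at h3
    rw [abs_le] at *
    constructor <;> linarith

end Count

/-! ### From deviations to limsup and liminf -/

/-- For `P n ≤ N < P (n + 1)` the numerator is at most `(n + 4) / 2` and the denominator at least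
`√(log (P n))`; along `W` the bound is attained up to `o(n)`. Keeping `D` abstract allows both signs
of the deviation. -/
lemma limsup_div_sqrt_log_eq {D e : ℕ → ℝ} {P W : ℕ → ℕ} {c : EReal} (hP0 : P 0 = 1)
    (hP : Tendsto P atTop atTop) (hPm : Monotone P) (hD : ∀ n N, N < P n → D N ≤ n / 2 + 3 / 2)
    (hW : Tendsto W atTop atTop) (hWP : ∀ n, W n < P n) (hDW : ∀ n, n / 2 - e n ≤ D (W n))
    (he : Tendsto (fun n => e n / n) atTop (𝓝 0))
    (hc : Tendsto (fun n : ℕ => (((n / 2) / √(Real.log (P n)) : ℝ) : EReal)) atTop (𝓝 c)) :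
    limsup (fun N => ((D N / √(Real.log N) : ℝ) : EReal)) atTop = c := by
  have hc0 : 0 ≤ c := ge_of_tendsto' hc fun n => by
    exact_mod_cast (by positivity : (0 : ℝ) ≤ (n / 2) / √(Real.log (P n)))
  apply le_antisymm
  · refine le_of_forall_gt_imp_ge_of_dense fun b hb => ?_
    -- Two intermediate reals: `b₂` bounds the ratios, and the room up to `b₁` absorbs the factor
    -- `(n + 4) / n`.
    obtain ⟨b₁, h1, hb1⟩ := EReal.lt_iff_exists_real_btwn.1 hb
    obtain ⟨b₂, h2, hb2⟩ := EReal.lt_iff_exists_real_btwn.1 h1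
    have hb2' : b₂ < b₁ := by exact_mod_cast hb2
    have hb2p : 0 < b₂ := by exact_mod_cast hc0.trans_lt h2
    have hev : ∀ᶠ n : ℕ in atTop, (n / 2) / √(Real.log (P n)) < b₂ := by
      filter_upwards [hc.eventually_lt_const h2] with n hn
      exact_mod_cast hn
    have hev2 : ∀ᶠ n : ℕ in atTop, b₂ * (n + 4) ≤ b₁ * n := by
      have : Tendsto (fun n : ℕ => (b₁ - b₂) * n) atTop atTop :=
        tendsto_natCast_atTop_atTop.const_mul_atTop (by linarith)
      filter_upwards [this.eventually_ge_atTop (b₂ * 4)] with n hn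
      linarith
    obtain ⟨n₀, hn₀⟩ := ((hev.and hev2).and (hP.eventually_gt_atTop 1)).exists_forall_of_atTop
    refine (limsup_le_of_le (h := ?_)).trans hb1.le
    filter_upwards [eventually_ge_atTop (P n₀)] with N hN
    obtain ⟨n, hn, hn'⟩ : ∃ n, P n ≤ N ∧ N < P (n + 1) := by
      have hex : ∃ n, N < P n := (hP.eventually_gt_atTop N).exists
      classical
      have hne : Nat.find hex ≠ 0 := fun h => by
        have h' := Nat.find_spec hex
        rw [h, hP0] at h'
        have := (hn₀ n₀ le_rfl).2
        omega
      obtain ⟨n, hn⟩ := Nat.exists_eq_succ_of_ne_zero hne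
      refine ⟨n, not_lt.1 (Nat.find_min hex (by omega)), ?_⟩
      have h' := Nat.find_spec hex
      rwa [hn] at h'
    have hnn : n₀ ≤ n := by
      by_contra h
      have := hPm (show n + 1 ≤ n₀ by omega)
      omega
    obtain ⟨⟨h3, h4⟩, h5⟩ := hn₀ n hnn
    have hlog : 0 < √(Real.log (P n)) := Real.sqrt_pos.2 (Real.log_pos (by exact_mod_cast h5))
    have hb1p : 0 < b₁ := hb2p.trans hb2'
    have hle : √(Real.log (P n)) ≤ √(Real.log N) := Real.sqrt_le_sqrt (Real.log_le_log
      (by exact_mod_cast (by omega : 0 < P n)) (by exact_mod_cast hn))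
    have h6 := hD _ _ hn'
    push_cast at h6
    rw [div_lt_iff₀ hlog] at h3
    have h7 : D N ≤ b₁ * √(Real.log N) := by
      have : b₂ * D N ≤ b₂ * (b₁ * √(Real.log N)) := by
        have : b₁ * (b₂ * √(Real.log (P n))) ≤ b₁ * (b₂ * √(Real.log N)) := by gcongr
        nlinarith
      exact le_of_mul_le_mul_left this hb2p
    exact_mod_cast (div_le_iff₀ (hlog.trans_le hle)).2 h7
  -- The alternative `b = 0` gives a nonnegative limsup, which settles negative lower bounds and
  -- thereby the case `c = 0`.
  · have key : ∀ b b' : ℝ, 0 ≤ b → b < b' ∨ b = 0 → (∀ᶠ n : ℕ in atTop,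
        b' ≤ (n / 2) / √(Real.log (P n))) →
        (b : EReal) ≤ limsup (fun N => ((D N / √(Real.log N) : ℝ) : EReal)) atTop := by
      intro b b' hb hbb hev
      refine le_limsup_of_frequently_le (hW.frequently (Eventually.frequently ?_))
      have hev3 : ∀ᶠ n : ℕ in atTop, 0 ≤ 1 - 2 * (e n / n) ∧ b ≤ b' * (1 - 2 * (e n / n)) ∨
          0 ≤ 1 - 2 * (e n / n) ∧ b = 0 := by
        have hlim : Tendsto (fun n => 1 - 2 * (e n / n)) atTop (𝓝 1) := by
          simpa using (he.const_mul 2).const_sub 1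
        rcases hbb with hbb | hbb
        · have h' : Tendsto (fun n => b' * (1 - 2 * (e n / n))) atTop (𝓝 b') := by
            simpa using hlim.const_mul b'
          filter_upwards [hlim.eventually_const_lt zero_lt_one, h'.eventually_const_lt hbb]
            with n h1 h2
          exact Or.inl ⟨h1.le, h2.le⟩
        · filter_upwards [hlim.eventually_const_lt zero_lt_one] with n h1
          exact Or.inr ⟨h1.le, hbb⟩
      filter_upwards [hev, hev3, eventually_gt_atTop 0, hW.eventually_gt_atTop 1]
        with n h1 h2 hn hWn
      have hn' : (0 : ℝ) < n := by exact_mod_cast hn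
      have hlogW : 0 < √(Real.log (W n)) := Real.sqrt_pos.2 (Real.log_pos (by exact_mod_cast hWn))
      have hle : √(Real.log (W n)) ≤ √(Real.log (P n)) := Real.sqrt_le_sqrt (Real.log_le_log
        (by exact_mod_cast (by omega : 0 < W n)) (by exact_mod_cast (hWP n).le))
      have e1 : (n / 2 - e n : ℝ) = n / 2 * (1 - 2 * (e n / n)) := by
        field_simp
      have h3 := hDW n
      rw [e1] at h3
      have hpos : 0 ≤ 1 - 2 * (e n / n) := by rcases h2 with h | h <;> exact h.1
      have h4 : (n / 2) / √(Real.log (P n)) * (1 - 2 * (e n / n)) ≤ D (W n) / √(Real.log (W n)) := by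
        calc _ = n / 2 * (1 - 2 * (e n / n)) / √(Real.log (P n)) := by ring
          _ ≤ n / 2 * (1 - 2 * (e n / n)) / √(Real.log (W n)) := by gcongr
          _ ≤ _ := by gcongr
      have h5 : b ≤ (n / 2) / √(Real.log (P n)) * (1 - 2 * (e n / n)) := by
        rcases h2 with h | h
        · exact h.2.trans (by gcongr)
        · rw [h.2]; positivity
      exact_mod_cast h5.trans h4
    have h0 := key 0 0 le_rfl (Or.inr rfl) (Eventually.of_forall fun n => by positivity)
    refine le_of_forall_lt_imp_le_of_dense fun b hb => ?_
    obtain ⟨b₁, hb1, h1⟩ := EReal.lt_iff_exists_real_btwn.1 hb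
    obtain ⟨b₂, hb2, h2⟩ := EReal.lt_iff_exists_real_btwn.1 h1
    have hb2' : b₁ < b₂ := by exact_mod_cast hb2
    rcases lt_or_ge b₁ 0 with hneg | hpos
    · refine hb1.le.trans (le_trans ?_ h0)
      exact_mod_cast hneg.le
    · refine hb1.le.trans (key b₁ b₂ hpos (Or.inl hb2') ?_)
      filter_upwards [hc.eventually_const_lt h2] with n hn
      exact le_of_lt (by exact_mod_cast hn)

/-- The deviations of a number are governed by the growth of the products of its Pierce digits. -/
lemma IsPierceSeq.pierceSum_mem_S {d : ℕ → ℕ} (hd : IsPierceSeq d) {α : ℝ≥0∞} {x : unitInterval}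
    (hx : (x : ℝ) = pierceSum d)
    (hc : Tendsto (fun n : ℕ => (((n / 2) / √(Real.log (digitProd d n)) : ℝ) : EReal)) atTop
      (𝓝 ((invSqrtTwoMul α : ℝ≥0∞) : EReal))) : x ∈ S α := by
  have hq : leapQuotient x = fun N => ((deviation d N / √(Real.log N) : ℝ) : EReal) := by
    funext N
    rw [leapQuotient, hx, deviation, funext hd.pierceDigit_pierceSum]
  -- The error is `o(n)` by Cesàro averaging, since `1 / d k → 0`.
  have he : Tendsto (fun n : ℕ => (3 / 2 + ∑ k ∈ range n, 1 / (d k : ℝ)) / n) atTop (𝓝 0) := by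
    have h1 : Tendsto (fun k => 1 / (d k : ℝ)) atTop (𝓝 0) := by
      simp only [one_div]
      exact tendsto_inv_atTop_zero.comp
        (tendsto_natCast_atTop_atTop.comp hd.strictMono.tendsto_atTop)
    have h2 := (tendsto_const_div_atTop_nhds_zero_nat (3 / 2 : ℝ)).add h1.cesaro
    rw [add_zero] at h2
    refine h2.congr fun n => ?_
    rw [add_div, inv_mul_eq_div]
  obtain ⟨W, hW, hWd⟩ := hd.exists_large_deviation 0
  obtain ⟨V, hV, hVd⟩ := hd.exists_large_deviation 1
  refine ⟨?_, ?_⟩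
  · rw [hq]
    refine limsup_div_sqrt_log_eq (digitProd_zero d) hd.tendsto_digitProd hd.digitProd_mono
      (fun n N h => (abs_le.1 (hd.abs_deviation_le h)).2) hW (fun n => (hWd n).1) (fun n => ?_) he hc
    have := (abs_le.1 (hWd n).2).1
    rw [pow_zero, one_mul] at this
    linarith
  · have h := limsup_div_sqrt_log_eq (D := fun N => - deviation d N) (digitProd_zero d)
      hd.tendsto_digitProd hd.digitProd_mono
      (fun n N h => by have := (abs_le.1 (hd.abs_deviation_le h)).1; linarith) hV
      (fun n => (hVd n).1) (fun n => ?_) he hc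
    · rw [← h, hq, ← EReal.liminf_neg]
      congr 1
      funext N
      simp [neg_div]
    · have := (abs_le.1 (hVd n).2).2
      rw [pow_one] at this
      linarith

/-! ### Separation of sums and coding by Cantor series -/

/-- Two expansions that differ for the first time at the position `n` have well separated sums. -/
lemma IsPierceSeq.le_pierceSum_sub {d e : ℕ → ℕ} (hd : IsPierceSeq d) (he : IsPierceSeq e) {n : ℕ}
    (h : ∀ k < n, d k = e k) (hn : d n < e n) (hn' : e n < d (n + 1)) :
    1 / ((digitProd d n : ℝ) * (d n * e n * d (n + 1))) ≤ |pierceSum d - pierceSum e| := by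
  have h1 := abs_sub_of_recursion (d := d) (u := fun k => pierceSum (LeapYear.tailSeq d k))
    (v := fun k => pierceSum (LeapYear.tailSeq e k)) (n := n) (fun k _ => hd.pos k)
    (fun k _ => hd.pierceSum_tailSeq k) (fun k hk => by rw [he.pierceSum_tailSeq, h k hk])
  simp only [tailSeq_zero] at h1
  have hp := hd.digitProd_cast_pos n
  rw [h1, mul_comm, ← div_div]
  gcongr
  refine le_trans ?_ (le_abs_self _)
  have a1 : pierceSum (LeapYear.tailSeq e n) ≤ 1 / e n := (he.tailSeq n).pierceSum_mem_Icc.2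
  have a2 : pierceSum (LeapYear.tailSeq d (n + 1)) ≤ 1 / d (n + 1) :=
    (hd.tailSeq (n + 1)).pierceSum_mem_Icc.2
  rw [hd.pierceSum_tailSeq n]
  have p1 := hd.cast_pos n
  have p2 := hd.cast_pos (n + 1)
  have p3 := he.cast_pos n
  have c1 : (d n : ℝ) + 1 ≤ e n := by exact_mod_cast hn
  have c2 : (e n : ℝ) + 1 ≤ d (n + 1) := by exact_mod_cast hn'
  calc (1 : ℝ) / (d n * e n * d (n + 1)) ≤ (1 - 1 / d (n + 1)) / d n - 1 / e n := by
        -- Over the common denominator the numerator is `d (n + 1) * (e n - d n) - e n - 1`,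
        -- nonnegative because `e n ≥ d n + 1` and `d (n + 1) ≥ e n + 1`.
        rw [← sub_nonneg]
        have : (1 - 1 / d (n + 1)) / d n - 1 / e n - (1 : ℝ) / (d n * e n * d (n + 1)) =
            ((d (n + 1) - 1) * e n - d n * d (n + 1) - 1) / (d n * e n * d (n + 1)) := by
          field_simp
        rw [this]
        refine div_nonneg ?_ (by positivity)
        nlinarith
    _ ≤ _ := by gcongr

section Cantor

variable {A N : ℕ → ℕ}

/-- The remainders in the expansion of `y` in the Cantor series with bases `N`. -/
noncomputable def cantorRem (N : ℕ → ℕ) (y : ℝ) : ℕ → ℝ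
  | 0 => y
  | k + 1 => Int.fract (N k * cantorRem N y k)

/-- The digits of `y` in the Cantor series with bases `N`. -/
noncomputable def cantorDigit (N : ℕ → ℕ) (y : ℝ) (k : ℕ) : ℕ := ⌊N k * cantorRem N y k⌋₊

lemma cantorRem_mem {y : ℝ} (hy : y ∈ Set.Ico (0 : ℝ) 1) (k : ℕ) :
    cantorRem N y k ∈ Set.Ico (0 : ℝ) 1 := by
  cases k with
  | zero => exact hy
  | succ k => exact ⟨Int.fract_nonneg _, Int.fract_lt_one _⟩

lemma cantorDigit_lt (hN : ∀ k, 0 < N k) {y : ℝ} (hy : y ∈ Set.Ico (0 : ℝ) 1) (k : ℕ) :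
    cantorDigit N y k < N k := by
  have h := cantorRem_mem (N := N) hy k
  have hk : (0 : ℝ) < N k := by exact_mod_cast hN k
  rw [cantorDigit, Nat.floor_lt (mul_nonneg hk.le h.1)]
  nlinarith [h.2]

lemma cantorRem_succ {y : ℝ} (hy : y ∈ Set.Ico (0 : ℝ) 1) (k : ℕ) :
    cantorRem N y (k + 1) = N k * cantorRem N y k - cantorDigit N y k := by
  have h := mul_nonneg (Nat.cast_nonneg (N k) : (0 : ℝ) ≤ N k) (cantorRem_mem (N := N) hy k).1
  rw [cantorRem, cantorDigit, Int.fract, natCast_floor_eq_intCast_floor h]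

/-- Each common digit `k` multiplies the difference of the remainders by `N k`, yet remainders stay
in `[0,1)`. -/
lemma abs_sub_le_of_cantorDigit_eq (hN : ∀ k, 0 < N k) {y z : ℝ} (hy : y ∈ Set.Ico (0 : ℝ) 1)
    (hz : z ∈ Set.Ico (0 : ℝ) 1) {n : ℕ} (h : ∀ k < n, cantorDigit N y k = cantorDigit N z k) :
    |y - z| ≤ 1 / (∏ k ∈ range n, (N k : ℝ)) := by
  have key : |y - z| = |cantorRem N y n - cantorRem N z n| / ∏ k ∈ range n, (N k : ℝ) := by
    induction n with
    | zero => simp [cantorRem]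
    | succ n ih =>
      have hn : (0 : ℝ) < N n := by exact_mod_cast hN n
      rw [ih fun k hk => h k (by omega), cantorRem_succ hy, cantorRem_succ hz, h n (by omega),
        sub_sub_sub_cancel_right, ← mul_sub, abs_mul, Nat.abs_cast, prod_range_succ,
        mul_comm (∏ k ∈ range n, (N k : ℝ)), mul_div_mul_left _ _ hn.ne']
  rw [key]
  have h1 := cantorRem_mem (N := N) hy n
  have h2 := cantorRem_mem (N := N) hz n
  gcongr
  rw [abs_le]
  constructor <;> linarith [h1.1, h1.2, h2.1, h2.2]

/-- The digit sequences `d` with `d_k` in the interval of length `N_k` to the right of `A_k`. -/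
def digitBox (A N : ℕ → ℕ) : Set (ℕ → ℕ) := {d | ∀ k, A k < d k ∧ d k ≤ A k + N k}

lemma isPierceSeq_of_mem_digitBox (hAN : ∀ k, A k + N k ≤ A (k + 1)) {d : ℕ → ℕ}
    (hd : d ∈ digitBox A N) : IsPierceSeq d :=
  ⟨(Nat.zero_le _).trans_lt (hd 0).1, strictMono_nat_of_lt_succ fun k =>
    ((hd k).2.trans (hAN k)).trans_lt (hd (k + 1)).1⟩

lemma digitProd_le_of_mem_digitBox {d : ℕ → ℕ} (hd : d ∈ digitBox A N) (n : ℕ) :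
    digitProd d n ≤ ∏ k ∈ range n, (A k + N k) :=
  prod_le_prod' fun k _ => (hd k).2

lemma le_abs_pierceSum_sub_of_mem_digitBox (hAN : ∀ k, A k + N k ≤ A (k + 1)) {d e : ℕ → ℕ}
    (hd : d ∈ digitBox A N) (he : e ∈ digitBox A N) {n : ℕ} (h : ∀ k < n, d k = e k)
    (hn : d n ≠ e n) :
    1 / ((∏ k ∈ range n, ((A k + N k : ℕ) : ℝ)) * ((A n + N n : ℕ) * (A n + N n : ℕ) *
      (A (n + 1) + N (n + 1) : ℕ))) ≤ |pierceSum d - pierceSum e| := by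
  wlog hlt : d n < e n generalizing d e
  · rw [abs_sub_comm]
    exact this he hd (fun k hk => (h k hk).symm) hn.symm (lt_of_le_of_ne (not_lt.1 hlt) hn.symm)
  have hd' := isPierceSeq_of_mem_digitBox hAN hd
  have he' := isPierceSeq_of_mem_digitBox hAN he
  refine le_trans ?_ (hd'.le_pierceSum_sub he' h hlt
    (((he n).2.trans (hAN n)).trans_lt (hd (n + 1)).1))
  have h0 := hd'.digitProd_cast_pos n
  have h1 := hd'.cast_pos n
  have h2 := he'.cast_pos n
  have h3 := hd'.cast_pos (n + 1)
  have h4 : (digitProd d n : ℝ) ≤ ∏ k ∈ range n, ((A k + N k : ℕ) : ℝ) := by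
    exact_mod_cast digitProd_le_of_mem_digitBox hd n
  have h5 := (hd n).2
  have h6 := (he n).2
  have h7 := (hd (n + 1)).2
  gcongr

/-- The hypothesis `hC` compares the separation of the Pierce sums with the length of the Cantor
cylinders. It makes the decoding map from sums to `[0,1)` Hölder of exponent `r`, and such a map
multiplies dimension by at most `1 / r`. -/
lemma le_dimH_of_prod_le (hN : ∀ k, 0 < N k) (hAN : ∀ k, A k + N k ≤ A (k + 1)) {r C : NNReal}
    (hr : 0 < r)
    (hC : ∀ n, ((∏ k ∈ range n, ((A k + N k : ℕ) : ℝ)) * ((A n + N n : ℕ) * (A n + N n : ℕ) *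
      (A (n + 1) + N (n + 1) : ℕ))) ^ (r : ℝ) ≤ C * ∏ k ∈ range n, (N k : ℝ)) :
    (r : ℝ≥0∞) ≤ dimH (pierceSum '' digitBox A N) := by
  -- The shift by 1 matches Cantor digits, which start at 0, with intervals open on the left.
  let D : ℝ → ℕ → ℕ := fun y k => A k + 1 + cantorDigit N y k
  have hD : ∀ y ∈ Set.Ico (0 : ℝ) 1, D y ∈ digitBox A N := fun y hy k => by
    have := cantorDigit_lt hN hy k
    simp only [D]
    omega
  let B : ℕ → ℝ := fun n => (∏ k ∈ range n, ((A k + N k : ℕ) : ℝ)) *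
    ((A n + N n : ℕ) * (A n + N n : ℕ) * (A (n + 1) + N (n + 1) : ℕ))
  have hU : ∀ k : ℕ, ((k : ℝ) + 1) ≤ ((A k + N k : ℕ) : ℝ) := fun k => by
    have : k + 1 ≤ A k + N k := by
      induction k with
      | zero => have := hN 0; omega
      | succ k ih => have := hAN k; have := hN (k + 1); omega
    exact_mod_cast this
  have hU1 : ∀ k : ℕ, 1 ≤ ((A k + N k : ℕ) : ℝ) := fun k =>
    le_trans (by linarith [(Nat.cast_nonneg k : (0 : ℝ) ≤ k)]) (hU k)
  have hprod1 : ∀ n, 1 ≤ ∏ k ∈ range n, ((A k + N k : ℕ) : ℝ) := fun n => by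
    have : ∏ k ∈ range n, (1 : ℝ) ≤ ∏ k ∈ range n, ((A k + N k : ℕ) : ℝ) :=
      prod_le_prod (fun _ _ => zero_le_one) fun k _ => hU1 k
    simpa using this
  have hB : ∀ n : ℕ, (n : ℝ) ≤ B n := fun n => by
    have h1 := hU n
    have h2 := one_le_mul_of_one_le_of_one_le (hU1 n) (hU1 (n + 1))
    have h3 := one_le_mul_of_one_le_of_one_le (hprod1 n) h2
    simp only [B]
    nlinarith [hU1 n]
  have hBpos : ∀ n, 0 < B n := fun n => by
    have := hprod1 n
    have := hU1 n
    have := hU1 (n + 1)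
    simp only [B]
    positivity
  have hNB : ∀ n, 1 / (∏ k ∈ range n, (N k : ℝ)) ≤ C * (1 / B n) ^ (r : ℝ) := fun n => by
    have hp : 0 < ∏ k ∈ range n, (N k : ℝ) := prod_pos fun k _ => by exact_mod_cast hN k
    rw [Real.div_rpow zero_le_one (hBpos n).le, Real.one_rpow, mul_one_div,
      div_le_div_iff₀ hp (Real.rpow_pos_of_pos (hBpos n) _), one_mul]
    exact hC n
  have hdist : ∀ y ∈ Set.Ico (0 : ℝ) 1, ∀ z ∈ Set.Ico (0 : ℝ) 1,
      |y - z| ≤ C * |pierceSum (D y) - pierceSum (D z)| ^ (r : ℝ) := fun y hy z hz => by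
    have hDy : ∀ k, D y k = D z k → cantorDigit N y k = cantorDigit N z k := fun k h => by
      simp only [D] at h
      omega
    by_cases heq : D y = D z
    · have hlim : Tendsto (fun n => C * (1 / B n) ^ (r : ℝ)) atTop (𝓝 0) := by
        have h1 : Tendsto B atTop atTop := tendsto_atTop_mono hB tendsto_natCast_atTop_atTop
        have h2 := ((tendsto_rpow_neg_atTop (NNReal.coe_pos.2 hr)).comp h1).const_mul (C : ℝ)
        rw [mul_zero] at h2
        refine h2.congr fun n => ?_
        simp [Real.rpow_neg (hBpos n).le, Real.inv_rpow (hBpos n).le]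
      have h0 : |y - z| ≤ 0 := ge_of_tendsto' hlim fun n =>
        (abs_sub_le_of_cantorDigit_eq hN hy hz
          fun k _ => hDy k (congrFun heq k)).trans (hNB n)
      exact h0.trans (by positivity)
    · have hex : ∃ n, D y n ≠ D z n := Function.ne_iff.1 heq
      classical
      have hmin : ∀ k < Nat.find hex, D y k = D z k := fun k hk => not_not.1 (Nat.find_min hex hk)
      refine ((abs_sub_le_of_cantorDigit_eq hN hy hz fun k hk => hDy k (hmin k hk)).trans
        (hNB _)).trans ?_
      gcongr
      exact le_abs_pierceSum_sub_of_mem_digitBox hAN (hD y hy) (hD z hz) hmin (Nat.find_spec hex)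
  have hinj : Set.InjOn (fun y => pierceSum (D y)) (Set.Ico (0 : ℝ) 1) := fun y hy z hz h => by
    have := hdist y hy z hz
    simp only at h
    rw [h, sub_self, abs_zero, Real.zero_rpow (NNReal.coe_pos.2 hr).ne', mul_zero] at this
    exact sub_eq_zero.1 (abs_nonpos_iff.1 this)
  let f := Function.invFunOn (fun y => pierceSum (D y)) (Set.Ico (0 : ℝ) 1)
  have hf : ∀ y ∈ Set.Ico (0 : ℝ) 1, f (pierceSum (D y)) = y := fun y hy =>
    hinj.leftInvOn_invFunOn hy
  have hol : HolderOnWith C r f ((fun y => pierceSum (D y)) '' Set.Ico (0 : ℝ) 1) := by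
    rintro _ ⟨y, hy, rfl⟩ _ ⟨z, hz, rfl⟩
    simp only [hf y hy, hf z hz, edist_dist, Real.dist_eq]
    rw [ENNReal.ofReal_rpow_of_nonneg (abs_nonneg _) r.coe_nonneg, ← ENNReal.ofReal_coe_nnreal,
      ← ENNReal.ofReal_mul C.coe_nonneg]
    exact ENNReal.ofReal_le_ofReal (hdist y hy z hz)
  have himg : f '' ((fun y => pierceSum (D y)) '' Set.Ico (0 : ℝ) 1) = Set.Ico (0 : ℝ) 1 := by
    rw [Set.image_image]
    exact (Set.image_congr hf).trans (Set.image_id' _)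
  have hdim := hol.dimH_image_le hr
  rw [himg, Real.dimH_of_nonempty_interior (by simp [interior_Ico]),
    ENNReal.le_div_iff_mul_le (Or.inl (by exact_mod_cast hr.ne')) (Or.inl ENNReal.coe_ne_top)]
    at hdim
  simp only [Module.finrank_self, Nat.cast_one, one_mul] at hdim
  refine hdim.trans (dimH_mono ?_)
  rintro _ ⟨y, hy, rfl⟩
  exact ⟨D y, hD y hy, rfl⟩

end Cantor

lemma tendsto_sum_range_atTop {f : ℕ → ℝ} (hf0 : ∀ k, 0 ≤ f k) (hf : Tendsto f atTop atTop) :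
    Tendsto (fun n => ∑ k ∈ range n, f k) atTop atTop :=
  (not_summable_iff_tendsto_nat_atTop_of_nonneg hf0).1 fun h =>
    not_tendsto_atTop_of_tendsto_nhds h.tendsto_atTop_zero hf

/-! ### Full dimension from logarithmic growth conditions -/

section Dimension

variable {A N : ℕ → ℕ}

/-- This is `hC` of `le_dimH_of_prod_le` in logarithms. Summing `hlogN` replaces `log (N k)` by the
endpoint logarithms at relative cost `o(1)`; the boundary terms are negligible, and `C` takes care
of small `n`. -/
lemma exists_mul_sum_log_le (hN : ∀ k, 0 < N k) (hAN : ∀ k, A k + N k ≤ A (k + 1))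
    (hlogN : (fun k => Real.log (A k + N k : ℕ) - Real.log (N k)) =o[atTop]
      fun k => Real.log (A k + N k : ℕ))
    (hlogA : (fun k => Real.log (A (k + 1) + N (k + 1) : ℕ) - Real.log (A k + N k : ℕ)) =o[atTop]
      fun k => Real.log (A k + N k : ℕ)) {r : ℝ} (hr0 : 0 < r) (hr : r < 1) :
    ∃ C : ℝ, ∀ n, r * (∑ k ∈ range n, Real.log (A k + N k : ℕ) + (2 * Real.log (A n + N n : ℕ) +
      Real.log (A (n + 1) + N (n + 1) : ℕ))) ≤ C + ∑ k ∈ range n, Real.log (N k) := by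
  set l : ℕ → ℝ := fun k => Real.log (A k + N k : ℕ) with hl
  have hl0 : ∀ k, 0 ≤ l k := fun k => Real.log_natCast_nonneg _
  have hmono : StrictMono fun k => A k + N k := strictMono_nat_of_lt_succ fun k =>
    lt_of_le_of_lt (hAN k) (by have := hN (k + 1); omega)
  have hltop : Tendsto l atTop atTop :=
    Real.tendsto_log_atTop.comp (tendsto_natCast_atTop_atTop.comp hmono.tendsto_atTop)
  have hS := tendsto_sum_range_atTop hl0 hltop
  have h1 := hlogN.sum_range hl0 hS
  have h2 := hlogA.sum_range hl0 hS
  -- A single term is `l 0` plus a telescoping sum of increments, each small relative to `l`.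
  have h3 : l =o[atTop] fun n => ∑ k ∈ range n, l k := by
    have hc : (fun _ : ℕ => l 0) =o[atTop] fun n => ∑ k ∈ range n, l k :=
      isLittleO_const_left.2 (Or.inr (tendsto_norm_atTop_atTop.comp hS))
    refine (h2.add hc).congr_left fun n => ?_
    rw [sum_range_sub l, sub_add_cancel]
  have h4 : (fun n => 2 * l n + l (n + 1)) =o[atTop] fun n => ∑ k ∈ range n, l k := by
    refine ((h3.const_mul_left 3).add (hlogA.trans h3)).congr_left fun n => ?_
    simp only [hl]
    ring
  have hev : ∀ᶠ n in atTop, r * (∑ k ∈ range n, l k + (2 * l n + l (n + 1))) -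
      ∑ k ∈ range n, Real.log (N k) ≤ 0 := by
    -- With `ε = (1 - r) / 2` one has `r * (1 + ε) ≤ 1 - ε`.
    have hε : 0 < (1 - r) / 2 := by linarith
    filter_upwards [isLittleO_iff.1 h1 hε, isLittleO_iff.1 h4 hε] with n h5 h6
    have hSn : 0 ≤ ∑ k ∈ range n, l k := sum_nonneg fun k _ => hl0 k
    rw [Real.norm_of_nonneg hSn] at h5 h6
    replace h5 := (le_abs_self _).trans h5
    replace h6 := (le_abs_self _).trans h6
    rw [sum_sub_distrib] at h5
    have : 0 ≤ ((1 - r) / 2) * ∑ k ∈ range n, l k := by positivity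
    nlinarith
  obtain ⟨C, hC⟩ := (isBoundedUnder_of_eventually_le hev).bddAbove_range
  refine ⟨C, fun n => ?_⟩
  have := hC ⟨n, rfl⟩
  simp only [hl] at this ⊢
  linarith

lemma one_le_dimH_image_digitBox (hN : ∀ k, 0 < N k) (hAN : ∀ k, A k + N k ≤ A (k + 1))
    (hlogN : (fun k => Real.log (A k + N k : ℕ) - Real.log (N k)) =o[atTop]
      fun k => Real.log (A k + N k : ℕ))
    (hlogA : (fun k => Real.log (A (k + 1) + N (k + 1) : ℕ) - Real.log (A k + N k : ℕ)) =o[atTop]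
      fun k => Real.log (A k + N k : ℕ)) :
    1 ≤ dimH (pierceSum '' digitBox A N) := by
  refine ENNReal.le_of_forall_nnreal_lt fun r hr => ?_
  have hr1 : (r : ℝ) < 1 := by exact_mod_cast hr
  rcases eq_or_ne r 0 with rfl | hr0
  · simp
  have hrpos : 0 < r := pos_iff_ne_zero.2 hr0
  obtain ⟨C, hC⟩ := exists_mul_sum_log_le hN hAN hlogN hlogA (NNReal.coe_pos.2 hrpos) hr1
  refine le_dimH_of_prod_le (C := (Real.exp C).toNNReal) hN hAN hrpos fun n => ?_
  have hU : ∀ k, (0 : ℝ) < ((A k + N k : ℕ) : ℝ) := fun k => by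
    have := hN k
    exact_mod_cast (by omega : 0 < A k + N k)
  have hNpos : ∀ k, (0 : ℝ) < N k := fun k => by exact_mod_cast hN k
  have h1 := hU n
  have h2 := hU (n + 1)
  have h3 : 0 < ∏ k ∈ range n, ((A k + N k : ℕ) : ℝ) := prod_pos fun k _ => hU k
  have h4 : 0 < ∏ k ∈ range n, (N k : ℝ) := prod_pos fun k _ => hNpos k
  have h5 := hC n
  rw [Real.coe_toNNReal _ (Real.exp_pos C).le, Real.rpow_def_of_pos (by positivity), ← Real.exp_log h4, ← Real.exp_add,
    Real.exp_le_exp, Real.log_mul h3.ne' (by positivity), Real.log_mul (by positivity) h2.ne',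
    Real.log_mul h1.ne' h1.ne', Real.log_prod (fun k _ => (hU k).ne'),
    Real.log_prod (fun k _ => (hNpos k).ne')]
  linarith

end Dimension

/-! ### From digit growth to product growth -/

section Growth

lemma sum_range_cast (n : ℕ) : ∑ k ∈ range n, (k : ℝ) = n * (n - 1) / 2 := by
  induction n with
  | zero => simp
  | succ n ih =>
    rw [sum_range_succ, ih]
    push_cast
    ring

lemma tendsto_sum_div_sq {L : ℕ → ℝ} (hL : ∀ k, 0 ≤ L k) {α : ℝ≥0∞}
    (h : Tendsto (fun k : ℕ => ENNReal.ofReal (L k / k)) atTop (𝓝 α)) :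
    Tendsto (fun n : ℕ => ENNReal.ofReal ((∑ k ∈ range n, L k) / (n : ℝ) ^ 2)) atTop
      (𝓝 (α / 2)) := by
  have hk0 : ∀ k : ℕ, (0 : ℝ) ≤ k := fun k => Nat.cast_nonneg k
  rcases eq_or_ne α ⊤ with rfl | hα
  · rw [ENNReal.top_div_of_ne_top (by norm_num), ENNReal.tendsto_ofReal_nhds_top,
      tendsto_atTop]
    rw [ENNReal.tendsto_ofReal_nhds_top] at h
    have hlin : Tendsto L atTop atTop := by
      refine tendsto_atTop_mono' _ ?_ tendsto_natCast_atTop_atTop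
      filter_upwards [h.eventually_ge_atTop 1, eventually_gt_atTop 0] with k hk hk'
      rwa [le_div_iff₀ (by exact_mod_cast hk'), one_mul] at hk
    have ho : (fun k : ℕ => (k : ℝ)) =o[atTop] L := by
      refine isLittleO_iff.2 fun c hc => ?_
      filter_upwards [h.eventually_ge_atTop c⁻¹, eventually_gt_atTop 0] with k hk hk'
      rw [le_div_iff₀ (by exact_mod_cast hk'), inv_mul_le_iff₀ hc] at hk
      rwa [Real.norm_of_nonneg (hk0 k), Real.norm_of_nonneg (hL k)]
    have hs := ho.sum_range hL (tendsto_sum_range_atTop hL hlin)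
    intro b
    -- The factor 4 comes from `n * (n - 1) / 2 ≥ n ^ 2 / 4` for `n ≥ 2`.
    have hb : 0 < 1 / (4 * (|b| + 1)) := by positivity
    filter_upwards [isLittleO_iff.1 hs hb, eventually_ge_atTop 2] with n hn hn2
    have hn2' : (2 : ℝ) ≤ n := by exact_mod_cast hn2
    rw [sum_range_cast, Real.norm_of_nonneg (by nlinarith),
      Real.norm_of_nonneg (sum_nonneg fun k _ => hL k), one_div_mul_eq_div,
      le_div_iff₀ (by positivity)] at hn
    rw [le_div_iff₀ (by positivity)]
    have h1 : b * (n : ℝ) ^ 2 ≤ (|b| + 1) * (n : ℝ) ^ 2 := by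
      have := le_abs_self b
      gcongr
      linarith
    have h2 : (|b| + 1) * (n : ℝ) ^ 2 ≤ (|b| + 1) * (2 * (n * (n - 1))) := by
      gcongr
      nlinarith
    linarith
  · have hr : Tendsto (fun k : ℕ => L k / k) atTop (𝓝 α.toReal) := by
      refine ((ENNReal.tendsto_toReal hα).comp h).congr fun k => ?_
      exact ENNReal.toReal_ofReal (div_nonneg (hL k) (hk0 k))
    have ho : (fun k : ℕ => L k - α.toReal * k) =o[atTop] fun k : ℕ => (k : ℝ) := by
      rw [isLittleO_iff_tendsto']
      · have := hr.sub_const α.toReal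
        rw [sub_self] at this
        refine this.congr' ?_
        filter_upwards [eventually_gt_atTop 0] with k hk
        have : (k : ℝ) ≠ 0 := by exact_mod_cast hk.ne'
        field_simp
      · filter_upwards [eventually_gt_atTop 0] with k hk h0
        exact absurd h0 (by exact_mod_cast hk.ne')
    have hs := ho.sum_range hk0 (tendsto_sum_range_atTop hk0 tendsto_natCast_atTop_atTop)
    have h1 := hs.tendsto_div_nhds_zero
    have h2 : Tendsto (fun n : ℕ => (∑ k ∈ range n, (k : ℝ)) / (n : ℝ) ^ 2) atTop (𝓝 (1 / 2)) := by
      have := (tendsto_one_div_atTop_nhds_zero_nat (𝕜 := ℝ)).const_sub 1 |>.div_const 2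
      rw [sub_zero] at this
      refine this.congr' ?_
      filter_upwards [eventually_gt_atTop 0] with n hn
      have : (n : ℝ) ≠ 0 := by exact_mod_cast hn.ne'
      rw [sum_range_cast]
      field_simp
    have h3 : Tendsto (fun n : ℕ => (∑ k ∈ range n, L k) / (n : ℝ) ^ 2) atTop
        (𝓝 (α.toReal / 2)) := by
      have := (h1.mul h2).add (h2.const_mul α.toReal)
      rw [zero_mul, zero_add, mul_one_div] at this
      refine this.congr' ?_
      filter_upwards [eventually_ge_atTop 2] with n hn
      have hn' : (2 : ℝ) ≤ n := by exact_mod_cast hn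
      have hne : ∑ k ∈ range n, (k : ℝ) ≠ 0 := by
        rw [sum_range_cast]
        have : (0 : ℝ) < n * (n - 1) := by nlinarith
        positivity
      rw [div_mul_div_cancel₀ hne, sum_sub_distrib, ← mul_sum]
      ring
    have h4 := ENNReal.tendsto_ofReal h3
    rwa [ENNReal.ofReal_div_of_pos (by norm_num), ENNReal.ofReal_toReal hα,
      ENNReal.ofReal_ofNat] at h4

/-- The ratio equals `1 / √(4 * log (P n) / n ^ 2)`, with `log (P n) / n ^ 2 → α / 2`. Passing to
the limit in `ℝ≥0∞` treats `α = 0` and `α = ∞` uniformly. -/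
lemma IsPierceSeq.tendsto_of_tendsto_log_div {d : ℕ → ℕ} (hd : IsPierceSeq d) {α : ℝ≥0∞}
    (h : Tendsto (fun k : ℕ => ENNReal.ofReal (Real.log (d k) / k)) atTop (𝓝 α)) :
    Tendsto (fun n : ℕ => (((n / 2) / √(Real.log (digitProd d n)) : ℝ) : EReal)) atTop
      (𝓝 ((invSqrtTwoMul α : ℝ≥0∞) : EReal)) := by
  have h1 := tendsto_sum_div_sq (fun k => Real.log_natCast_nonneg (d k)) h
  have hlog : ∀ n, ∑ k ∈ range n, Real.log (d k) = Real.log (digitProd d n) := fun n => by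
    rw [digitProd, Nat.cast_prod, Real.log_prod fun k _ => (hd.cast_pos k).ne']
  simp only [hlog] at h1
  have h2 : Tendsto (fun n : ℕ => 1 / (4 * ENNReal.ofReal (Real.log (digitProd d n) / (n : ℝ) ^ 2))
      ^ (1 / 2 : ℝ)) atTop (𝓝 (invSqrtTwoMul α)) := by
    have e : 4 * (α / 2) = 2 * α := by
      rw [ENNReal.div_eq_inv_mul, ← mul_assoc, show (4 : ℝ≥0∞) = 2 * 2 by norm_num, mul_assoc 2 2,
        ENNReal.mul_inv_cancel (by norm_num) (by norm_num), mul_one]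
    have h3 := ((ENNReal.Tendsto.const_mul (a := 4) h1 (Or.inr (by norm_num))).ennrpow_const
      (1 / 2)).inv
    rw [e] at h3
    simpa only [invSqrtTwoMul, one_div] using h3
  refine ((continuous_coe_ennreal_ereal.tendsto _).comp h2).congr' ?_
  filter_upwards [hd.tendsto_digitProd.eventually_gt_atTop 1, eventually_gt_atTop 0] with n hn hn0
  have hl : 0 < Real.log (digitProd d n) := Real.log_pos (by exact_mod_cast hn)
  have hn0' : (0 : ℝ) < n := by exact_mod_cast hn0
  have e1 : (n / 2) / √(Real.log (digitProd d n)) =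
      1 / (4 * (Real.log (digitProd d n) / (n : ℝ) ^ 2)) ^ (1 / 2 : ℝ) := by
    rw [← Real.sqrt_eq_rpow, ← mul_div_assoc, Real.sqrt_div (by positivity),
      Real.sqrt_sq hn0'.le, Real.sqrt_mul (by norm_num),
      show (4 : ℝ) = 2 ^ 2 by norm_num, Real.sqrt_sq (by norm_num)]
    field_simp
  rw [e1, Function.comp_apply]
  have e2 : 1 / (4 * ENNReal.ofReal (Real.log (digitProd d n) / (n : ℝ) ^ 2)) ^ (1 / 2 : ℝ) =
      ENNReal.ofReal (1 / (4 * (Real.log (digitProd d n) / (n : ℝ) ^ 2)) ^ (1 / 2 : ℝ)) := by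
    simp only [one_div]
    rw [ENNReal.ofReal_inv_of_pos (by positivity),
      ← ENNReal.ofReal_rpow_of_pos (by positivity), ENNReal.ofReal_mul (by norm_num),
      ENNReal.ofReal_ofNat]
  rw [e2, EReal.coe_ennreal_ofReal, max_eq_left (by positivity)]

end Growth

/-! ### Regular growth functions -/

/-- Functions that grow to infinity regularly, faster than the logarithm and slowly enough to be
asymptotically invariant under shifts. -/
structure IsRegularGrowth (g : ℕ → ℝ) : Prop where
  tendsto : Tendsto g atTop atTop
  shift : (fun k => g (k + 1)) ~[atTop] g
  log : (fun k : ℕ => Real.log k) =o[atTop] g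
  -- This gives `exp (g (k + 1)) - exp (g k) ≥ exp (g k) / (k + 1)`; by the previous field the loss
  -- of `log (k + 1)` is negligible against `g`.
  gap : ∀ᶠ k : ℕ in atTop, 1 / ((k : ℝ) + 1) ≤ g (k + 1) - g k

lemma isRegularGrowth_sqrt : IsRegularGrowth fun k : ℕ => √(k : ℝ) := by
  have ht : Tendsto (fun k : ℕ => √(k : ℝ)) atTop atTop :=
    Real.tendsto_sqrt_atTop.comp tendsto_natCast_atTop_atTop
  have e : ∀ k : ℕ, (√((k : ℝ) + 1) - √(k : ℝ)) * (√((k : ℝ) + 1) + √(k : ℝ)) = 1 := fun k => by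
    have h1 := Real.sq_sqrt (by positivity : (0 : ℝ) ≤ (k : ℝ) + 1)
    have h2 := Real.sq_sqrt (by positivity : (0 : ℝ) ≤ (k : ℝ))
    linear_combination h1 - h2
  refine ⟨ht, ?_, ?_, ?_⟩
  · have h1 : (fun _ : ℕ => (1 : ℝ)) =o[atTop] fun k : ℕ => √(k : ℝ) :=
      isLittleO_const_left.2 (Or.inr (tendsto_norm_atTop_atTop.comp ht))
    refine IsBigO.trans_isLittleO (IsBigO.of_bound 1 (Eventually.of_forall fun k => ?_)) h1
    simp only [Pi.sub_apply, Nat.cast_add, Nat.cast_one]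
    have h1 : (1 : ℝ) ≤ √((k : ℝ) + 1) :=
      Real.one_le_sqrt.2 (by linarith [(Nat.cast_nonneg k : (0 : ℝ) ≤ k)])
    have h2 := Real.sqrt_nonneg (k : ℝ)
    have h3 : √(k : ℝ) ≤ √((k : ℝ) + 1) := Real.sqrt_le_sqrt (by linarith)
    rw [Real.norm_of_nonneg (by linarith), norm_one, one_mul]
    nlinarith [e k]
  · have := (isLittleO_log_rpow_atTop (r := 1 / 2) (by norm_num)).comp_tendsto
      (tendsto_natCast_atTop_atTop (R := ℝ))
    simpa only [Function.comp_def, ← Real.sqrt_eq_rpow] using this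
  · filter_upwards [eventually_ge_atTop 3] with k hk
    have hk' : (3 : ℝ) ≤ k := by exact_mod_cast hk
    push_cast
    have h2 : (2 : ℝ) ≤ √((k : ℝ) + 1) := Real.le_sqrt_of_sq_le (by linarith)
    have h3 : √(k : ℝ) ≤ √((k : ℝ) + 1) := Real.sqrt_le_sqrt (by linarith)
    have h4 := Real.sq_sqrt (by positivity : (0 : ℝ) ≤ (k : ℝ) + 1)
    have h5 : √((k : ℝ) + 1) + √(k : ℝ) ≤ (k : ℝ) + 1 := by nlinarith
    rw [div_le_iff₀ (by positivity)]
    exact (e k).ge.trans (mul_le_mul_of_nonneg_left h5 (by linarith))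

lemma isLittleO_log_natCast : (fun k : ℕ => Real.log k) =o[atTop] fun k : ℕ => (k : ℝ) :=
  Real.isLittleO_log_id_atTop.comp_tendsto (tendsto_natCast_atTop_atTop (R := ℝ))

lemma isLittleO_one_natCast : (fun _ : ℕ => (1 : ℝ)) =o[atTop] fun k : ℕ => (k : ℝ) :=
  isLittleO_const_left.2 (Or.inr (tendsto_norm_atTop_atTop.comp tendsto_natCast_atTop_atTop))

lemma isLittleO_natCast_sq : (fun k : ℕ => (k : ℝ)) =o[atTop] fun k : ℕ => (k : ℝ) ^ 2 := by
  have := (isBigO_refl (fun k : ℕ => (k : ℝ)) atTop).mul_isLittleO isLittleO_one_natCast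
  simpa [pow_two] using this

lemma isRegularGrowth_mul {a : ℝ} (ha : 0 < a) : IsRegularGrowth fun k : ℕ => a * k := by
  have hO : (fun k : ℕ => (k : ℝ)) =O[atTop] fun k : ℕ => a * k :=
    (isBigO_refl _ _).const_mul_right ha.ne'
  refine ⟨tendsto_natCast_atTop_atTop.const_mul_atTop ha, ?_, isLittleO_log_natCast.trans_isBigO hO,
    ?_⟩
  · refine ((isLittleO_one_natCast.const_mul_left a).trans_isBigO hO).congr_left fun k => ?_
    simp only [Pi.sub_apply]
    push_cast
    ring
  · have := tendsto_one_div_add_atTop_nhds_zero_nat (𝕜 := ℝ)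
    filter_upwards [this.eventually_lt_const ha] with k hk
    push_cast
    linarith

lemma isRegularGrowth_sq : IsRegularGrowth fun k : ℕ => (k : ℝ) ^ 2 := by
  refine ⟨(tendsto_pow_atTop two_ne_zero).comp tendsto_natCast_atTop_atTop, ?_,
    isLittleO_log_natCast.trans isLittleO_natCast_sq, Eventually.of_forall fun k => ?_⟩
  · refine ((isLittleO_natCast_sq.const_mul_left 2).add
      (isLittleO_one_natCast.trans isLittleO_natCast_sq)).congr_left fun k => ?_
    simp only [Pi.sub_apply]
    push_cast
    ring
  · have hk : (0 : ℝ) ≤ k := Nat.cast_nonneg k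
    push_cast
    rw [div_le_iff₀ (by positivity)]
    nlinarith

/-- For `α = 0` the growth must be `o(k)` and still dominate `log k`, whence the square root. -/
lemma exists_isRegularGrowth (α : ℝ≥0∞) : ∃ g, IsRegularGrowth g ∧
    Tendsto (fun k : ℕ => ENNReal.ofReal (g k / k)) atTop (𝓝 α) := by
  rcases eq_or_ne α ⊤ with rfl | hα
  · refine ⟨_, isRegularGrowth_sq, ENNReal.tendsto_ofReal_nhds_top.2 ?_⟩
    refine (tendsto_natCast_atTop_atTop (R := ℝ)).congr' ?_
    filter_upwards [eventually_gt_atTop 0] with k hk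
    have : (k : ℝ) ≠ 0 := by exact_mod_cast hk.ne'
    field_simp
  rcases eq_or_ne α 0 with rfl | hα0
  · refine ⟨_, isRegularGrowth_sqrt, ?_⟩
    have : Tendsto (fun k : ℕ => √(k : ℝ) / k) atTop (𝓝 0) := by
      simp only [Real.sqrt_div_self]
      exact (tendsto_inv_atTop_zero.comp isRegularGrowth_sqrt.tendsto).congr fun k => by simp
    simpa using ENNReal.tendsto_ofReal this
  · refine ⟨_, isRegularGrowth_mul (ENNReal.toReal_pos hα0 hα), tendsto_const_nhds.congr' ?_⟩
    filter_upwards [eventually_gt_atTop 0] with k hk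
    have : (k : ℝ) ≠ 0 := by exact_mod_cast hk.ne'
    rw [mul_div_assoc, div_self this, mul_one, ENNReal.ofReal_toReal hα]

/-! ### Digit boxes between consecutive values of `⌊exp g⌋` -/

/-- The integers `⌊exp (g k)⌋`. -/
noncomputable def floorExp (g : ℕ → ℝ) (k : ℕ) : ℕ := ⌊Real.exp (g k)⌋₊

namespace IsRegularGrowth

variable {g : ℕ → ℝ}

lemma shift_add (hg : IsRegularGrowth g) (q : ℕ) : (fun k => g (k + q)) ~[atTop] g := by
  induction q with
  | zero => exact IsEquivalent.refl
  | succ q ih =>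
    refine IsEquivalent.trans ?_ ih
    have := hg.shift.comp_tendsto (tendsto_add_atTop_nat q)
    simpa only [Function.comp_def, add_assoc] using this

lemma const_isLittleO (hg : IsRegularGrowth g) (c : ℝ) : (fun _ : ℕ => c) =o[atTop] g :=
  isLittleO_const_left.2 (Or.inr (tendsto_norm_atTop_atTop.comp hg.tendsto))

lemma log_floorExp (hg : IsRegularGrowth g) :
    (fun k => Real.log (floorExp g k)) ~[atTop] g := by
  refine IsBigO.trans_isLittleO (IsBigO.of_bound 1 ?_) (hg.const_isLittleO (Real.log 2))
  filter_upwards [hg.tendsto.eventually_ge_atTop 1] with k hk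
  have h1 : 2 ≤ Real.exp (g k) := by linarith [Real.add_one_le_exp (g k)]
  have h2 : (floorExp g k : ℝ) ≤ Real.exp (g k) := Nat.floor_le (Real.exp_pos _).le
  have h3 : Real.exp (g k) / 2 ≤ floorExp g k := by
    have := Nat.lt_floor_add_one (Real.exp (g k))
    simp only [floorExp]
    linarith
  have h4 : (0 : ℝ) < floorExp g k := by linarith
  have h5 := Real.log_le_log h4 h2
  have h6 := Real.log_le_log (by positivity) h3
  rw [Real.log_div (Real.exp_pos _).ne' two_ne_zero, Real.log_exp] at h6
  rw [Real.log_exp] at h5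
  have h7 := Real.log_pos one_lt_two
  rw [Pi.sub_apply, Real.norm_eq_abs, one_mul, Real.norm_of_nonneg h7.le, abs_le]
  constructor <;> linarith

lemma log_floorExp_add (hg : IsRegularGrowth g) (q : ℕ) :
    (fun k => Real.log (floorExp g (k + q))) ~[atTop] g :=
  (hg.log_floorExp.comp_tendsto (tendsto_add_atTop_nat q)).trans (hg.shift_add q)

lemma tendsto_floorExp (hg : IsRegularGrowth g) : Tendsto (floorExp g) atTop atTop :=
  tendsto_nat_floor_atTop.comp (Real.tendsto_exp_atTop.comp hg.tendsto)

lemma log_four_mul (hg : IsRegularGrowth g) :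
    (fun k : ℕ => Real.log (4 * k)) =o[atTop] g := by
  refine ((hg.const_isLittleO (Real.log 4)).add hg.log).congr' ?_ EventuallyEq.rfl
  filter_upwards [eventually_gt_atTop 0] with k hk
  rw [Real.log_mul (by norm_num) (by exact_mod_cast hk.ne')]

/-- The exponentials differ by at least twice `exp (g k) / (4 * k)`. This quantity is eventually at
least 1, so one copy absorbs the rounding and the other remains. -/
lemma floorExp_gap (hg : IsRegularGrowth g) : ∀ᶠ k in atTop, floorExp g k < floorExp g (k + 1) ∧
    g k - Real.log (4 * k) ≤ Real.log (floorExp g (k + 1) - floorExp g k : ℕ) := by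
  filter_upwards [hg.gap, isLittleO_iff.1 hg.log_four_mul one_pos, eventually_ge_atTop 1,
    hg.tendsto.eventually_ge_atTop 0] with k h1 h2 hk hg0
  have hk' : (1 : ℝ) ≤ k := by exact_mod_cast hk
  rw [Real.norm_of_nonneg hg0, one_mul] at h2
  replace h2 := (le_abs_self _).trans h2
  have h3 : 4 * (k : ℝ) ≤ Real.exp (g k) := (Real.log_le_iff_le_exp (by positivity)).1 h2
  have h4 : Real.exp (g k) * (1 / ((k : ℝ) + 1)) ≤ Real.exp (g (k + 1)) - Real.exp (g k) := by
    have h5 := Real.add_one_le_exp (g (k + 1) - g k)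
    have h6 : Real.exp (g (k + 1)) = Real.exp (g k) * Real.exp (g (k + 1) - g k) := by
      rw [← Real.exp_add, add_sub_cancel]
    rw [h6]
    nlinarith [Real.exp_pos (g k)]
  have h5 : Real.exp (g k) * (1 / (2 * k)) ≤ Real.exp (g k) * (1 / ((k : ℝ) + 1)) := by
    gcongr
    linarith
  have h6 : Real.exp (g k) * (1 / (2 * k)) = 2 * (Real.exp (g k) / (4 * k)) := by
    field_simp
    norm_num
  have h7 : 1 ≤ Real.exp (g k) / (4 * k) := (one_le_div (by positivity)).2 h3
  have h8 : Real.exp (g k) / (4 * k) ≤ (floorExp g (k + 1) : ℝ) - floorExp g k := by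
    have a1 := Nat.lt_floor_add_one (Real.exp (g (k + 1)))
    have a2 := Nat.floor_le (Real.exp_pos (g k)).le
    simp only [floorExp]
    linarith
  have h9 : floorExp g k < floorExp g (k + 1) := by
    have : (floorExp g k : ℝ) < floorExp g (k + 1) := by linarith
    exact_mod_cast this
  refine ⟨h9, ?_⟩
  rw [Nat.cast_sub h9.le]
  have h10 := Real.log_le_log (by positivity) h8
  rwa [Real.log_div (Real.exp_pos _).ne' (by positivity), Real.log_exp] at h10

lemma log_floorExp_sub (hg : IsRegularGrowth g) :
    (fun k => Real.log (floorExp g (k + 1)) -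
      Real.log (floorExp g (k + 1) - floorExp g k : ℕ)) =o[atTop] g := by
  have h1 := ((hg.log_floorExp_add 1).isLittleO).add hg.log_four_mul
  refine IsBigO.trans_isLittleO (IsBigO.of_bound 1 ?_) h1
  filter_upwards [hg.floorExp_gap] with k hk
  have h2 : Real.log (floorExp g (k + 1) - floorExp g k : ℕ) ≤ Real.log (floorExp g (k + 1)) :=
    Real.log_le_log (by exact_mod_cast (by omega : 0 < floorExp g (k + 1) - floorExp g k))
      (by exact_mod_cast (by omega : floorExp g (k + 1) - floorExp g k ≤ floorExp g (k + 1)))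
  rw [Real.norm_of_nonneg (by linarith), one_mul]
  refine le_trans ?_ (le_abs_self _)
  simp only [Pi.sub_apply]
  linarith [hk.2]

lemma tendsto_ofReal_div (hg : IsRegularGrowth g) {α : ℝ≥0∞}
    (hα : Tendsto (fun k : ℕ => ENNReal.ofReal (g k / k)) atTop (𝓝 α)) {h : ℕ → ℝ}
    (hh : h ~[atTop] g) : Tendsto (fun k : ℕ => ENNReal.ofReal (h k / k)) atTop (𝓝 α) := by
  have hg0 : ∀ᶠ k in atTop, 0 < g k := hg.tendsto.eventually_gt_atTop 0
  have h1 := (isEquivalent_iff_tendsto_one (hg0.mono fun k hk => hk.ne')).1 hh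
  have h2 := ENNReal.Tendsto.mul (ENNReal.tendsto_ofReal h1) (Or.inl (by simp)) hα
    (Or.inr (by simp))
  rw [ENNReal.ofReal_one, one_mul] at h2
  refine h2.congr' ?_
  filter_upwards [hg0] with k hk
  rw [← ENNReal.ofReal_mul' (by positivity), Pi.div_apply, ← mul_div_assoc,
    div_mul_cancel₀ _ hk.ne']

/-- For every prefix there is a box of continuations that carries full dimension and on which the
digits grow at the prescribed rate. -/
lemma exists_digitBox (hg : IsRegularGrowth g) {α : ℝ≥0∞}
    (hα : Tendsto (fun k : ℕ => ENNReal.ofReal (g k / k)) atTop (𝓝 α)) {a : ℕ → ℕ}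
    (ha : IsPierceSeq a) (p : ℕ) :
    ∃ A N : ℕ → ℕ, (∀ k, A k + N k ≤ A (k + 1)) ∧ 1 ≤ dimH (pierceSum '' digitBox A N) ∧
      ∀ d ∈ digitBox A N, (∀ k < p, d k = a k) ∧
        Tendsto (fun k : ℕ => ENNReal.ofReal (Real.log (d k) / k)) atTop (𝓝 α) := by
  -- The shift `q` puts every free interval above `a p`, beyond the prefix, and makes it nonempty.
  obtain ⟨q, hq⟩ := ((hg.floorExp_gap.and
    (hg.tendsto_floorExp.eventually_ge_atTop (a p))).exists_forall_of_atTop)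
  -- Before `p` the box allows only the digit `a k`; from `p` on its intervals are adjacent.
  let A : ℕ → ℕ := fun k => if k < p then a k - 1 else floorExp g (k + q)
  let N : ℕ → ℕ := fun k => if k < p then 1 else floorExp g (k + q + 1) - floorExp g (k + q)
  have hlt : ∀ k, floorExp g (k + q) < floorExp g (k + q + 1) := fun k =>
    (hq (k + q) (by omega)).1.1
  have hN : ∀ k, 0 < N k := fun k => by
    have := hlt k
    simp only [N]
    split_ifs <;> omega
  have hsum : ∀ k, p ≤ k → A k + N k = floorExp g (k + (q + 1)) := fun k hk => by
    have := hlt k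
    simp only [A, N, if_neg (not_lt.2 hk), ← add_assoc]
    omega
  have hAN : ∀ k, A k + N k ≤ A (k + 1) := fun k => by
    rcases lt_or_ge k p with hk | hk
    · have h1 := ha.pos k
      have h2 := ha.strictMono (Nat.lt_add_one k)
      have h3 := ha.strictMono.monotone (show k + 1 ≤ p by omega)
      have h4 := (hq (k + 1 + q) (by omega)).2
      simp only [A, N, if_pos hk]
      split_ifs <;> omega
    · rw [hsum k hk]
      simp only [A, if_neg (not_lt.2 (show p ≤ k + 1 by omega))]
      rw [show k + 1 + q = k + (q + 1) by ring]
  have hU : (fun k => Real.log (A k + N k : ℕ)) ~[atTop] g := by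
    refine (hg.log_floorExp_add (q + 1)).congr_left ?_
    filter_upwards [eventually_ge_atTop p] with k hk
    rw [hsum k hk]
  have hlogN : (fun k => Real.log (A k + N k : ℕ) - Real.log (N k)) =o[atTop]
      fun k => Real.log (A k + N k : ℕ) := by
    have h1 := (hg.log_floorExp_sub.comp_tendsto (tendsto_add_atTop_nat q)).trans_isBigO
      (hg.shift_add q).isBigO
    refine (h1.trans_isBigO hU.isBigO_symm).congr' ?_ EventuallyEq.rfl
    filter_upwards [eventually_ge_atTop p] with k hk
    rw [hsum k hk]
    simp only [Function.comp_apply, N, if_neg (not_lt.2 hk), ← add_assoc]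
  have hlogA : (fun k => Real.log (A (k + 1) + N (k + 1) : ℕ) - Real.log (A k + N k : ℕ)) =o[atTop]
      fun k => Real.log (A k + N k : ℕ) := by
    have h1 : (fun k => Real.log (A (k + 1) + N (k + 1) : ℕ)) ~[atTop] g :=
      (hU.comp_tendsto (tendsto_add_atTop_nat 1)).trans hg.shift
    exact (h1.trans hU.symm).isLittleO
  refine ⟨A, N, hAN, one_le_dimH_image_digitBox hN hAN hlogN hlogA, fun d hd => ⟨fun k hk => ?_, ?_⟩⟩
  · have h1 := hd k
    have h2 := ha.pos k
    simp only [A, N, if_pos hk] at h1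
    omega
  · refine tendsto_of_tendsto_of_tendsto_of_le_of_le'
      (hg.tendsto_ofReal_div hα (hg.log_floorExp_add q))
      (hg.tendsto_ofReal_div hα (hg.log_floorExp_add (q + 1))) ?_ ?_
    · have hpos := (hg.tendsto_floorExp.comp (tendsto_add_atTop_nat q)).eventually_gt_atTop 0
      filter_upwards [eventually_ge_atTop p, hpos] with k hk hk0
      have h1 := (hd k).1
      simp only [A, if_neg (not_lt.2 hk)] at h1
      have hk0' : (0 : ℝ) < floorExp g (k + q) := by exact_mod_cast hk0
      gcongr
    · filter_upwards [eventually_ge_atTop p] with k hk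
      have h1 := (hd k).2
      rw [hsum k hk] at h1
      have hk0 : (0 : ℝ) < d k := by exact_mod_cast (Nat.zero_le _).trans_lt (hd k).1
      gcongr

end IsRegularGrowth

/-! ### Localisation and conclusion -/

lemma dimH_inter_S (α : ℝ≥0∞) {U : Set unitInterval} (hU : IsOpen U) (hne : U.Nonempty) :
    dimH (U ∩ S α) = 1 := by
  rw [← (isometry_subtype_coe (s := unitInterval)).dimH_image]
  apply le_antisymm
  · exact (dimH_mono (Set.subset_univ _)).trans Real.dimH_univ.le
  obtain ⟨x, hx⟩ := hne
  obtain ⟨δ, hδ, hball⟩ := Metric.isOpen_iff.1 hU x hx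
  -- The point `x` may be rational or an endpoint, so an irrational `z` in `(0,1)` within `δ / 2` of
  -- it replaces it; the prefix contributes the other `δ / 2`.
  obtain ⟨z, hz, hz1, hz2⟩ := exists_irrational_btwn
    (show max 0 ((x : ℝ) - δ / 2) < min 1 ((x : ℝ) + δ / 2) by
      rw [max_lt_iff, lt_min_iff, lt_min_iff]
      have := x.2.1
      have := x.2.2
      refine ⟨⟨?_, ?_⟩, ?_, ?_⟩ <;> linarith)
  rw [max_lt_iff] at hz1
  rw [lt_min_iff] at hz2
  obtain ⟨a, p, ha, hap⟩ := exists_prefix hz hz1.1 hz2.1 (half_pos hδ)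
  obtain ⟨g, hg, hgα⟩ := exists_isRegularGrowth α
  obtain ⟨A, N, hAN, hdim, hbox⟩ := hg.exists_digitBox hgα ha p
  refine hdim.trans (dimH_mono ?_)
  rintro _ ⟨d, hd, rfl⟩
  have hd' := isPierceSeq_of_mem_digitBox hAN hd
  refine ⟨⟨pierceSum d, hd'.pierceSum_pos.le, hd'.pierceSum_le_one⟩, ⟨hball ?_, ?_⟩, rfl⟩
  · have h1 := abs_lt.1 (hap d hd' (hbox d hd).1)
    rw [Metric.mem_ball, Subtype.dist_eq, Real.dist_eq, abs_lt]
    constructor <;> simp only <;> linarith [h1.1, h1.2, hz1.2, hz2.2]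
  · exact hd'.pierceSum_mem_S rfl (hd'.tendsto_of_tendsto_log_div (hbox d hd).2)

end LeapYear

theorem theorem1p3 (α : ℝ≥0∞) :
    Dense (LeapYear.S α) ∧
      ∀ U : Set unitInterval, IsOpen U → U.Nonempty → dimH (U ∩ LeapYear.S α) = 1 := by
  refine ⟨dense_iff_inter_open.2 fun U hU hne => ?_, fun U hU hne => LeapYear.dimH_inter_S α hU hne⟩
  -- Density follows from the dimension statement, as the empty set has dimension 0.
  by_contra h
  have := LeapYear.dimH_inter_S α hU hne
  rw [Set.not_nonempty_iff_eq_empty.1 h, dimH_empty] at this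
  exact zero_ne_one this
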